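/- **Theorem (lower bound for batch-dynamic minimum spanning forests in the $k$-machine model).** *Setting.* Graphs are simple undirected graphs on $\{1,\dots,n\}$ with integer edge weights in $\{0,\dots,W\}$. The $n$ vertices are distributed independently and uniformly at random over $k$ machines (random vertex partition). A machine initially sees exactly the edges with an endpoint on it, and knows the partition. A *batch of size $N$* is a set of $N$ updates of pairwise distinct vertex pairs, each inserting an absent edge (with a weight) or deleting a present edge; when a batch arrives, each update is seen exactly by the machine(s) hosting its endpoints. Machines work in synchronous rounds; per round, each machine sends to each other machine a message of at most $C\lceil\log_2 n\rceil$ bits. Algorithms are randomized with public coins (independent of the partition) and have unrestricted local computation and memory. They may first run an initialisation phase on the initial graph, which is not counted. The number of rounds of a batch is the number of communication rounds from its arrival until all machines have finished (and $\infty$ if that never happens); then the next batch arrives. An algorithm *maintains a minimum spanning forest with error $\varepsilon$* on sequences of batches from an initial graph $G_0$ if, for every such sequence (fixed in advance) and every batch of it, with probability at least $1-\varepsilon$ the batch is completed and, at its completion, there is a minimum spanning forest $F$ of the current graph (a minimum spanning tree if the graph is connected) such that each machine knows, for each edge living on it, whether the edge belongs to $F$. *Statement.* Fix constants $\delta>0$,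 $\varepsilon<1$ and $C\in\mathbb N$, and let $n=n(k)$ satisfy $n(k)\ge k^{1+\delta/2}$ for all large $k$ and $\log n(k)=o(k^{\delta/2})$ (for instance, $n$ polynomial in $k$ with $n \ge k^{1+\delta/2}$). There is a function $f(k)=\omega(k)$, depending only on $\delta,\varepsilon,C$ and $n(\cdot)$, such that for all sufficiently large $k$, all $W\ge 1$ and every initial graph $G_0$ on $n(k)$ vertices with weights in $\{1,\dots,W\}$, there is a random sequence of $3k$ batches, each of size exactly $\lfloor k^{1+\delta}\rfloor$ and with inserted weights in $\{0,\dots,W\}$, such that every algorithm that maintains a minimum spanning forest with error $\varepsilon$ on the sequences of $3k$ batches of this size from $G_0$ needs at least $f(k)$ rounds in total, in expectation, to process these $3k$ batches. In particular, for every such algorithm there is a fixed sequence of $3k$ batches, each of size $\lfloor k^{1+\delta}\rfloor$, for which its expected total number of rounds is at least $f(k)=\omega(k)$, and on which some single batch takes at least $f(k)/(3k)=\omega(1)$ rounds in expectation; so batches of $k^{1+\delta}$ updates cannot be handled in $O(1)$ rounds. -/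

import Mathlib

open Filter Topology MeasureTheory
open scoped ENNReal NNReal

noncomputable section

namespace KMachine

/-! ### Weighted graphs, minimum spanning forests and batches of updates -/

/-- Unordered pairs of distinct vertices: the potential edges of a simple graph on `Fin n`. -/
abbrev Pair (n : ℕ) : Type := {e : Sym2 (Fin n) // ¬ e.IsDiag}

/-- A simple undirected graph on `Fin n` with integer edge weights in `{0, …, W}`:
`G e = none` means that `e` is not an edge, `G e = some w` that it is an edge of weight `w`. -/
abbrev WGraph (n W : ℕ) : Type := Pair n → Option (Fin (W + 1))

variable {k n W B m : ℕ}

/-- The simple graph on `Fin n` whose edges are the members of `F`. -/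
def graphOf (F : Set (Pair n)) : SimpleGraph (Fin n) :=
  SimpleGraph.fromEdgeSet (Subtype.val '' F)

/-- The set of edges of a weighted graph. -/
def edges (G : WGraph n W) : Set (Pair n) := {e | G e ≠ none}

/-- `F` is a spanning forest of `G`: an acyclic set of edges of `G` that connects the same pairs of
vertices as `G`. For connected `G` these are exactly the spanning trees of `G`. -/
def IsSpanningForest (G : WGraph n W) (F : Finset (Pair n)) : Prop :=
  (F : Set (Pair n)) ⊆ edges G ∧ (graphOf (F : Set (Pair n))).IsAcyclic ∧
    ∀ u v, (graphOf (edges G)).Reachable u v → (graphOf (F : Set (Pair n))).Reachable u v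

/-- Total weight of a set of edges (non-edges contribute nothing). -/
def weight (G : WGraph n W) (F : Finset (Pair n)) : ℕ :=
  ∑ e ∈ F, (G e).elim 0 (fun w => (w : ℕ))

/-- `F` is a minimum spanning forest of `G` (a minimum spanning tree if `G` is connected). -/
def IsMSF (G : WGraph n W) (F : Finset (Pair n)) : Prop :=
  IsSpanningForest G F ∧ ∀ F', IsSpanningForest G F' → weight G F ≤ weight G F'

/-- A single edge update. -/
inductive Update (W : ℕ) : Type
  | insert (w : Fin (W + 1)) : Update W
  | delete : Update W

/-- A batch of edge updates, at most one for each pair of vertices; `none` means no update. -/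
abbrev Batch (n W : ℕ) : Type := Pair n → Option (Update W)

/-- The number of updates in a batch. -/
def batchSize (b : Batch n W) : ℕ := {e | b e ≠ none}.ncard

/-- Only absent edges are inserted and only present edges are deleted. -/
def ValidBatch (G : WGraph n W) (b : Batch n W) : Prop :=
  ∀ e, (∀ w, b e = some (Update.insert w) → G e = none) ∧
    (b e = some Update.delete → G e ≠ none)

/-- The graph after a batch. -/
def applyBatch (G : WGraph n W) (b : Batch n W) : WGraph n W := fun e =>
  match b e with
  | none => G e
  | some (Update.insert w) => some w
  | some Update.delete => none

/-- The graph after the first `j` batches of a sequence. -/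
def graphAfter (G₀ : WGraph n W) (bs : Fin m → Batch n W) : ℕ → WGraph n W
  | 0 => G₀
  | j + 1 => if h : j < m then applyBatch (graphAfter G₀ bs j) (bs ⟨j, h⟩)
      else graphAfter G₀ bs j

/-- A sequence of batches, each containing exactly `N` updates, that can be applied one after the
other starting from `G₀`. -/
def ValidSeq (G₀ : WGraph n W) (N : ℕ) (bs : Fin m → Batch n W) : Prop :=
  ∀ j : Fin m, ValidBatch (graphAfter G₀ bs j) (bs j) ∧ batchSize (bs j) = N

/-! ### The `k`-machine model -/

/-- A message on one link in one round: a bit string of length at most `B`. -/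
abbrev Message (B : ℕ) : Type := {l : List Bool // l.length ≤ B}

/-- The pair `e` lives on machine `i` when the vertices are distributed by `π`: one of its
endpoints is hosted by `i`. -/
def LivesOn (π : Fin n → Fin k) (i : Fin k) (e : Pair n) : Prop := ∃ v ∈ e.1, π v = i

open Classical in
/-- The part of edge data (a graph or a batch) that machine `i` gets to see. -/
def localPart {α : Type} (π : Fin n → Fin k) (i : Fin k) (f : Pair n → Option α) :
    Pair n → Option α :=
  fun e => if LivesOn π i e then f e else none

/-- What a machine can observe: the arrival of (its part of) a batch, or, in a communication
round, the messages received from all machines. -/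
inductive Event (k n W B : ℕ) : Type
  | batch (b : Batch n W) : Event k n W B
  | round (msgs : Fin k → Message B) : Event k n W B

/-- Everything a machine knows (apart from the random coins): its name, the vertex partition,
the initial edges living on it, and the chronological list of its observations. -/
structure View (k n W B : ℕ) : Type where
  me : Fin k
  part : Fin n → Fin k
  init : WGraph n W
  log : List (Event k n W B)

/-- A protocol for fixed coins. There is no bound on local computation or memory: the messages that
a machine sends in the next round (one to each machine), whether it considers the current batch
as completed, and its claim about which edges are in the forest, are arbitrary functions of
its view. -/
structure Protocol (k n W B : ℕ) : Type where
  send : View k n W B → Fin k → Message B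
  finished : View k n W B → Bool
  output : View k n W B → Pair n → Bool

/-- The observations of all machines. -/
abbrev Config (k n W B : ℕ) : Type := Fin k → List (Event k n W B)

namespace Protocol

variable (P : Protocol k n W B) (π : Fin n → Fin k) (G₀ : WGraph n W)

/-- The view of machine `i`. -/
def view (c : Config k n W B) (i : Fin k) : View k n W B :=
  ⟨i, π, localPart π i G₀, c i⟩

/-- One synchronous communication round. -/
def step (c : Config k n W B) : Config k n W B := fun i =>
  c i ++ [Event.round (fun j => P.send (view π G₀ c j) i)]

/-- All machines consider the current batch as completed. -/
def AllFinished (c : Config k n W B) : Prop := ∀ i, P.finished (view π G₀ c i) = true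

/-- A batch arrives; each machine only sees the updates of edges that live on it. -/
def deliver (b : Batch n W) (c : Config k n W B) : Config k n W B := fun i =>
  c i ++ [Event.batch (localPart π i b)]

open Classical in
/-- Run communication rounds until, for the first time, all machines have finished; return the
number of rounds and the resulting configuration (`none` if this never happens). -/
def run (c : Config k n W B) : Option (ℕ × Config k n W B) :=
  if h : ∃ r, P.AllFinished π G₀ ((P.step π G₀)^[r] c) then
    some (Nat.find h, (P.step π G₀)^[Nat.find h] c)
  else none

/-- Stage `0` is the initialisation on the initial graph; in stage `j + 1` the batch with index `j`
arrives (once stage `j` is over) and is processed. The value is the number of rounds of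
the stage and the configuration at its end, or `none` if some stage so far does not end. -/
def stage (bs : Fin m → Batch n W) : ℕ → Option (ℕ × Config k n W B)
  | 0 => P.run π G₀ (fun _ => [])
  | j + 1 => if h : j < m then
      (stage bs j).bind (fun s => P.run π G₀ (deliver π (bs ⟨j, h⟩) s.2))
      else none

/-- The number of rounds used to process the batch with index `j` (`∞` if never completed). -/
def batchRounds (bs : Fin m → Batch n W) (j : Fin m) : ℝ≥0∞ :=
  match P.stage π G₀ bs (j + 1) with
  | some s => (s.1 : ℝ≥0∞)
  | none => ⊤

/-- The total number of rounds used to process all batches; initialisation is not counted. -/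
def totalRounds (bs : Fin m → Batch n W) : ℝ≥0∞ := ∑ j, P.batchRounds π G₀ bs j

/-- In configuration `c` the machines hold a minimum spanning forest of `G`: for a single
minimum spanning forest, each machine knows of each edge living on it whether it belongs to
the forest. -/
def OutputCorrect (c : Config k n W B) (G : WGraph n W) : Prop :=
  ∃ F, IsMSF G F ∧ ∀ i, ∀ e ∈ edges G, LivesOn π i e →
    (P.output (view π G₀ c i) e = true ↔ e ∈ F)

/-- The batch with index `j` is completed, and then the output is correct. -/
def BatchCorrect (bs : Fin m → Batch n W) (j : Fin m) : Prop :=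
  ∃ s, P.stage π G₀ bs (j + 1) = some s ∧
    P.OutputCorrect π G₀ s.2 (graphAfter G₀ bs (j + 1))

end Protocol

/-- A randomized (public-coin) dynamic algorithm for `k` machines. -/
structure Algorithm (k n W B : ℕ) : Type 1 where
  Coin : Type
  [mCoin : MeasurableSpace Coin]
  μ : Measure Coin
  [prob_μ : IsProbabilityMeasure μ]
  proto : Coin → Protocol k n W B
  measurable_send : ∀ v i x, MeasurableSet {ω | (proto ω).send v i = x}
  measurable_finished : ∀ v, MeasurableSet {ω | (proto ω).finished v = true}
  measurable_output : ∀ v e, MeasurableSet {ω | (proto ω).output v e = true}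

attribute [instance] Algorithm.mCoin Algorithm.prob_μ

namespace Algorithm

variable (A : Algorithm k n W B)

/-- Expectation over the coins and an independent uniformly random vertex partition. -/
def expect (g : (Fin n → Fin k) → A.Coin → ℝ≥0∞) : ℝ≥0∞ :=
  (∑ π, ∫⁻ ω, g π ω ∂A.μ) / (k : ℝ≥0∞) ^ n

/-- Probability over the coins and an independent uniformly random vertex partition. -/
def probability (E : (Fin n → Fin k) → A.Coin → Prop) : ℝ≥0∞ :=
  (∑ π, A.μ {ω | E π ω}) / (k : ℝ≥0∞) ^ n

/-- Expected number of rounds for the batch with index `j`. -/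
def expectedBatchRounds (G₀ : WGraph n W) (bs : Fin m → Batch n W) (j : Fin m) : ℝ≥0∞ :=
  A.expect (fun π ω => (A.proto ω).batchRounds π G₀ bs j)

/-- Expected total number of rounds for a sequence of batches. -/
def expectedTotalRounds (G₀ : WGraph n W) (bs : Fin m → Batch n W) : ℝ≥0∞ :=
  A.expect (fun π ω => (A.proto ω).totalRounds π G₀ bs)

/-- The algorithm maintains a minimum spanning forest of the graph, initially `G₀`, with error
probability at most `ε`, under all sequences of `m` batches of `N` updates. -/
def MaintainsMSF (G₀ : WGraph n W) (m N : ℕ) (ε : ℝ) : Prop :=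
  ∀ bs : Fin m → Batch n W, ValidSeq G₀ N bs → ∀ j : Fin m,
    ENNReal.ofReal (1 - ε) ≤
      A.probability (fun π ω => (A.proto ω).BatchCorrect π G₀ bs j)

end Algorithm

end KMachine

end

/-! Take two hubs and `L` leaves, each leaf joined to both hubs by a spoke. After batch `0` has
cleared the spokes, batches of odd index insert all spokes and the following ones delete them again.
Each insertion gives every spoke an independent fair bit, weight 0 if it is set and weight 1
otherwise; non-spoke pairs, used to fill the batches to size `N`, never have weight 0.

If a spoke has weight 0 and the leaf's other spoke does not, it lies in every minimum spanning
forest (`IsMSF.mem_of_unique_zero`). So a machine hosting one hub that correctly excludes a zero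
spoke has asserted the bit of the other spoke. Among the leaves with both bits set, at most one
keeps both spokes, since two would close a 4-cycle. About a quarter of the leaves have both bits
set, so one of the two hub machines asserts many bits correctly (`exists_guess_of_batchCorrect`).

For most partitions the hubs are on different machines and at least half of the leaves share no
machine with a hub; the asserted bits of such leaves are invisible to the asserting machine. For a
fixed sequence of received messages the assertion does not depend on the hidden bits, so `t` correct
assertions have probability at most `2⁻ᵗ` (`card_guess_mul_le`). A machine receives at most `2 ^ (2
* (B * k + 1) * R)` message sequences in `R` rounds, and a union bound excludes fast correct
processing unless `R` is of order `t / (B * k)`. With `t` of order `k ^ (1 + δ/2)` and `B = C *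
Nat.clog 2 n`, where `log n = o(k ^ (δ/2))`, this `R` tends to infinity.

Averaging over bits, partition and coins, each insertion batch costs at least `R * (1 - ε) / 2`
expected rounds (`le_sum_expectedBatchRounds`), and there are at least `k` of them. -/

noncomputable section

namespace KMachine

/-! ### Counting lemmas -/

section Counting

open Classical in
/-- Guessing hidden bits: if `g b` is a set of hidden coordinates that is determined by the
coordinates that are not hidden, then only a fraction `2⁻ᵗ` of the bit vectors `b` are true on all of
`g b` while `g b` has at least `t` elements. -/
theorem card_guess_mul_le {ι : Type*} [Fintype ι] [DecidableEq ι] (S : Finset ι) (g : (ι → Bool) → Finset ι)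
    (hgS : ∀ b, g b ⊆ S) (hg : ∀ b b' : ι → Bool, (∀ i ∉ S, b i = b' i) → g b = g b') (t : ℕ) :
    (Finset.univ.filter fun b : ι → Bool => t ≤ (g b).card ∧ ∀ i ∈ g b, b i = true).card * 2 ^ t ≤
      Fintype.card (ι → Bool) := by
  set E := Finset.univ.filter fun b : ι → Bool => t ≤ (g b).card ∧ ∀ i ∈ g b, b i = true with hE
  -- Switching off any subset `A` of the guessed coordinates changes only hidden bits, so `g` is
  -- unchanged and `A` can be read off as the false coordinates in `g`. Each `b` in `E` thus yields
  -- at least `2 ^ t` vectors, all distinct.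
  let flip : (Σ _ : ι → Bool, Finset ι) → ι → Bool := fun x i => if i ∈ x.2 then false else x.1 i
  have hflip : ∀ b A, A ⊆ g b → g (flip ⟨b, A⟩) = g b := fun b A hA =>
    hg _ _ fun i hi => if_neg fun h => hi (hgS _ (hA h))
  have hinj : Set.InjOn flip (E.sigma fun b => (g b).powerset : Finset (Σ _ : ι → Bool, Finset ι)) := by
    rintro ⟨b, A⟩ hb ⟨b', A'⟩ hb' h
    simp only [Finset.coe_sigma, Set.mem_sigma_iff, Finset.mem_coe, Finset.mem_powerset, hE,
      Finset.mem_filter, Finset.mem_univ, true_and] at hb hb'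
    obtain ⟨⟨-, hb⟩, hA⟩ := hb
    obtain ⟨⟨-, hb'⟩, hA'⟩ := hb'
    have hgg : g b = g b' := by rw [← hflip b A hA, h, hflip b' A' hA']
    have hAA : A = A' := by
      ext i
      have hi := congrFun h i
      simp only [flip] at hi
      constructor
      · intro hiA
        by_contra hn
        rw [if_pos hiA, if_neg hn, hb' i (hgg ▸ hA hiA)] at hi
        cases hi
      · intro hiA
        by_contra hn
        rw [if_neg hn, if_pos hiA, hb i (hgg ▸ hA' hiA)] at hi
        cases hi
    subst hAA
    have hbb : b = b' := by
      funext i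
      by_cases hi : i ∈ A
      · rw [hb i (hA hi), hb' i (hA' hi)]
      · have := congrFun h i
        simpa only [flip, if_neg hi] using this
    rw [hbb]
  calc E.card * 2 ^ t = ∑ _b ∈ E, 2 ^ t := by simp
    _ ≤ ∑ b ∈ E, ((g b).powerset).card := by
        refine Finset.sum_le_sum fun b hb => ?_
        rw [Finset.card_powerset]
        exact Nat.pow_le_pow_right two_pos (Finset.mem_filter.1 hb).2.1
    _ = (E.sigma fun b => (g b).powerset).card := (Finset.card_sigma _ _).symm
    _ ≤ (Finset.univ : Finset (ι → Bool)).card :=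
        Finset.card_le_card_of_injOn flip (fun _ _ => Finset.mem_univ _) hinj
    _ = _ := rfl

open Classical in
/-- Large deviation bound for the number of indices in `S` at which two independent fair bits are
both true. -/
theorem card_few_both_true_le {J : Type*} [Fintype J] [DecidableEq J] (S : Finset J) (a : ℕ) :
    ((Finset.univ.filter fun b : J × Bool → Bool =>
        (S.filter fun i => ∀ c, b (i, c) = true).card < a).card : ℝ) ≤
      2 ^ a * (7 / 8) ^ S.card * Fintype.card (J × Bool → Bool) := by
  -- Exponential moment method: a factor 1/2 for each index of `S` with both bits set. Its mean over
  -- two fair bits is `1/4 * 1/2 + 3/4 = 7/8`, and Markov's inequality contributes `2 ^ a`.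
  let h : J → (Bool → Bool) → ℝ := fun i f => if i ∈ S ∧ ∀ c, f c = true then 1 / 2 else 1
  have hprod : ∀ b : J × Bool → Bool,
      ∏ i, h i (fun c => b (i, c)) = (1 / 2) ^ (S.filter fun i => ∀ c, b (i, c) = true).card := by
    intro b
    simp only [h]
    rw [Finset.prod_ite, Finset.prod_const, Finset.prod_const_one, mul_one]
    congr 2
    ext i
    simp
  have hsum : ∑ b : J × Bool → Bool, ∏ i, h i (fun c => b (i, c)) =
      (7 / 8) ^ S.card * Fintype.card (J × Bool → Bool) := by
    rw [← Equiv.sum_comp (Equiv.curry J Bool Bool).symm]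
    have : ∀ f : J → Bool → Bool,
        ∏ i, h i (fun c => (Equiv.curry J Bool Bool).symm f (i, c)) = ∏ i, h i (f i) := fun f => rfl
    simp only [this]
    rw [← Fintype.piFinset_univ, ← Finset.prod_univ_sum]
    have hi : ∀ i, ∑ f : Bool → Bool, h i f = (if i ∈ S then 7 / 8 else 1) * 4 := by
      intro i
      by_cases hi : i ∈ S
      · simp only [h, hi, true_and, if_true]
        rw [Finset.sum_ite]
        have h1 : (Finset.univ.filter fun f : Bool → Bool => ∀ c, f c = true).card = 1 := by
          decide
        have h2 : (Finset.univ.filter fun f : Bool → Bool => ¬ ∀ c, f c = true).card = 3 := by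
          decide
        rw [Finset.sum_const, Finset.sum_const]
        have e1 : (Finset.univ.filter fun f : Bool → Bool => ∀ c, f c = true).card = 1 := by
          convert h1
        have e2 : (Finset.univ.filter fun f : Bool → Bool => ¬ ∀ c, f c = true).card = 3 := by
          convert h2
        rw [e1, e2]
        norm_num
      · simp [h, hi]
    simp only [hi]
    rw [Finset.prod_mul_distrib, Finset.prod_ite, Finset.prod_const, Finset.prod_const_one, mul_one,
      Finset.prod_const]
    congr 1
    · simp
    · simp only [Finset.card_univ, Fintype.card_fun, Fintype.card_prod, Fintype.card_bool]
      rw [mul_comm, pow_mul]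
      norm_num
  rw [mul_assoc, ← hsum, Finset.mul_sum, Finset.card_eq_sum_ones, Nat.cast_sum]
  calc _ ≤ ∑ b ∈ Finset.univ.filter fun b : J × Bool → Bool =>
        (S.filter fun i => ∀ c, b (i, c) = true).card < a,
          (2 : ℝ) ^ a * ∏ i, h i (fun c => b (i, c)) := by
        refine Finset.sum_le_sum fun b hb => ?_
        rw [hprod, Nat.cast_one, one_div, inv_pow, ← div_eq_mul_inv, one_le_div (by positivity)]
        exact pow_le_pow_right₀ one_le_two (Finset.mem_filter.1 hb).2.le
    _ ≤ _ := by
        refine Finset.sum_le_sum_of_subset_of_nonneg (Finset.subset_univ _) fun b _ _ => ?_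
        rw [hprod]
        positivity

/-- There are at most `(|α| + 1) ^ m` lists of length at most `m` over a finite alphabet. -/
theorem finite_and_card_lists_le (α : Type*) [Finite α] (m : ℕ) :
    Finite {l : List α // l.length ≤ m} ∧
      Nat.card {l : List α // l.length ≤ m} ≤ (Nat.card α + 1) ^ m := by
  let F : {l : List α // l.length ≤ m} → Fin m → Option α := fun l i => l.1[(i : ℕ)]?
  have hF : Function.Injective F := by
    rintro ⟨l, hl⟩ ⟨l', hl'⟩ h
    rw [Subtype.mk.injEq]
    apply List.ext_getElem?
    intro i
    by_cases hi : i < m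
    · exact congrFun h ⟨i, hi⟩
    · rw [List.getElem?_eq_none (by omega), List.getElem?_eq_none (by omega)]
  refine ⟨Finite.of_injective F hF, ?_⟩
  have := Nat.card_le_card_of_injective F hF
  rwa [Nat.card_fun, Finite.card_option, Nat.card_fin] at this

/-- Two vertices are hosted by the same machine with probability `1 / k`. -/
theorem card_collision_mul {k n : ℕ} {x y : Fin n} (hxy : x ≠ y) :
    (Finset.univ.filter fun π : Fin n → Fin k => π x = π y).card * k = k ^ n := by
  classical
  -- Shifting the host of `x` by `c` shows that all `k` values of `π x - π y` are equally frequent.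
  have key : ∀ c : Fin k, (Finset.univ.filter fun π : Fin n → Fin k => π x = π y).card =
      (Finset.univ.filter fun π : Fin n → Fin k => π x = π y + c).card := by
    intro c
    have : NeZero k := ⟨fun h => by subst h; exact c.elim0⟩
    refine Finset.card_bij (fun π _ => Function.update π x (π x + c)) ?_ ?_ ?_
    · intro π hπ
      simp only [Finset.mem_filter, Finset.mem_univ, true_and] at hπ ⊢
      rw [Function.update_self, Function.update_of_ne hxy.symm, hπ]
    · intro π hπ π' hπ' h
      funext z
      have hz := congrFun h z
      by_cases hzx : z = x
      · subst hzx
        simpa using hz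
      · simpa [Function.update_of_ne hzx] using hz
    · intro π hπ
      simp only [Finset.mem_filter, Finset.mem_univ, true_and] at hπ
      refine ⟨Function.update π x (π y), ?_, ?_⟩
      · simp [Function.update_of_ne hxy.symm]
      · funext z
        by_cases hzx : z = x
        · subst hzx; simp [hπ]
        · simp [Function.update_of_ne hzx]
  rcases Nat.eq_zero_or_pos k with rfl | hk
  · have : n ≠ 0 := fun h => by subst h; exact x.elim0
    simp [this]
  have : NeZero k := ⟨hk.ne'⟩
  calc _ = ∑ c : Fin k, (Finset.univ.filter fun π : Fin n → Fin k => π x = π y + c).card := by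
        rw [← Finset.sum_congr rfl fun c _ => key c, Finset.sum_const, Finset.card_univ,
          Fintype.card_fin, smul_eq_mul, mul_comm]
    _ = ∑ c : Fin k, (Finset.univ.filter fun π : Fin n → Fin k => π x - π y = c).card := by
        refine Finset.sum_congr rfl fun c _ => ?_
        congr 1
        ext π
        simp [sub_eq_iff_eq_add, add_comm]
    _ = (Finset.univ : Finset (Fin n → Fin k)).card :=
        (Finset.card_eq_sum_card_fiberwise fun _ _ => Finset.mem_univ _).symm
    _ = k ^ n := by simp

end Counting

/-! ### Minimum spanning forests -/

section Forests

variable {n W : ℕ}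

theorem graphOf_adj {F : Set (Pair n)} {a b : Fin n} :
    (graphOf F).Adj a b ↔ ∃ h : ¬ (s(a, b) : Sym2 (Fin n)).IsDiag, (⟨s(a, b), h⟩ : Pair n) ∈ F := by
  simp only [graphOf, SimpleGraph.fromEdgeSet_adj, Set.mem_image, Subtype.exists,
    exists_and_right, exists_eq_right]
  constructor
  · rintro ⟨⟨h, hF⟩, -⟩
    exact ⟨h, hF⟩
  · rintro ⟨h, hF⟩
    exact ⟨⟨h, hF⟩, fun hab => h (Sym2.mk_isDiag_iff.2 hab)⟩

theorem graphOf_mono {F F' : Set (Pair n)} (h : F ⊆ F') : graphOf F ≤ graphOf F' := by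
  intro a b hab
  rw [graphOf_adj] at hab ⊢
  exact hab.imp fun _ h' => h h'

theorem reachable_of_forall_adj {V : Type*} {H H' : SimpleGraph V}
    (h : ∀ a b, H.Adj a b → H'.Reachable a b) {a b : V} (hab : H.Reachable a b) :
    H'.Reachable a b := by
  obtain ⟨p⟩ := hab
  induction p with
  | nil => exact SimpleGraph.Reachable.refl _
  | cons hadj _ ih => exact (h _ _ hadj).trans ih

/-- If an edge of weight zero is the only edge of weight zero at one of its endpoints, then it lies in
every minimum spanning forest. -/
theorem IsMSF.mem_of_unique_zero {G : WGraph n W} {F : Finset (Pair n)} (hF : IsMSF G F)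
    {x v : Fin n} (hxv : ¬ (s(x, v) : Sym2 (Fin n)).IsDiag) (h0 : G ⟨s(x, v), hxv⟩ = some 0)
    (hz : ∀ e : Pair n, v ∈ e.1 → e.1 ≠ s(x, v) → G e ≠ some 0) :
    (⟨s(x, v), hxv⟩ : Pair n) ∈ F := by
  classical
  by_contra hnot
  obtain ⟨⟨hFG, hac, hspan⟩, hmin⟩ := hF
  have hvx : v ≠ x := fun h => hxv (Sym2.mk_isDiag_iff.2 h.symm)
  have hreach : (graphOf (F : Set (Pair n))).Reachable v x := by
    apply hspan
    apply SimpleGraph.Adj.reachable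
    apply SimpleGraph.Adj.symm
    rw [graphOf_adj]
    exact ⟨hxv, by simp [edges, h0]⟩
  -- Exchange argument: the first edge `f` of the forest path from `v` to `x` has positive weight.
  -- Removing it separates `v` from the rest of the path, and adding the zero edge reconnects them,
  -- giving a lighter spanning forest.
  obtain ⟨p, hp⟩ := hreach.exists_isPath
  cases p with
  | nil => exact hvx rfl
  | @cons _ y _ hadj q =>
    rw [SimpleGraph.Walk.cons_isPath_iff] at hp
    obtain ⟨hvy, hfF⟩ := graphOf_adj.1 hadj
    set f : Pair n := ⟨s(v, y), hvy⟩ with hf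
    set e₀ : Pair n := ⟨s(x, v), hxv⟩ with he₀
    have hfe : f ≠ e₀ := fun h => hnot (h ▸ hfF)
    have hfne : f.1 ≠ s(x, v) := fun h => hfe (Subtype.ext h)
    set K := graphOf ((F.erase f : Finset (Pair n)) : Set (Pair n)) with hK
    have hKH : K ≤ graphOf (F : Set (Pair n)) :=
      graphOf_mono (by exact_mod_cast Finset.erase_subset f F)
    have hadjK : ∀ a b, (graphOf (F : Set (Pair n))).Adj a b → s(a, b) ≠ s(v, y) → K.Adj a b := by
      intro a b hab hne
      obtain ⟨hd, hm⟩ := graphOf_adj.1 hab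
      rw [hK, graphOf_adj]
      refine ⟨hd, ?_⟩
      rw [Finset.mem_coe, Finset.mem_erase]
      exact ⟨fun h => hne (congrArg Subtype.val h), hm⟩
    have hyx : K.Reachable y x := by
      refine ⟨q.transfer K fun e he => ?_⟩
      induction e using Sym2.ind with
      | _ a b =>
        rw [SimpleGraph.mem_edgeSet]
        refine hadjK a b (q.adj_of_mem_edges he) fun h => hp.2 ?_
        have hva : v ∈ s(a, b) := h ▸ Sym2.mem_mk_left v y
        rcases Sym2.mem_iff.1 hva with rfl | rfl
        · exact q.fst_mem_support_of_mem_edges he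
        · exact q.snd_mem_support_of_mem_edges he
    have hnvy : ¬ K.Reachable v y := by
      intro h
      have hb := SimpleGraph.isAcyclic_iff_forall_adj_isBridge.1 hac hadj
      refine hb (h.mono ?_)
      intro a b hab
      rw [SimpleGraph.deleteEdges_adj]
      refine ⟨hKH hab, ?_⟩
      rw [Set.mem_singleton_iff]
      intro he
      obtain ⟨hd, hm⟩ := graphOf_adj.1 hab
      rw [Finset.mem_coe, Finset.mem_erase] at hm
      exact hm.1 (Subtype.ext he)
    have hnxv : ¬ K.Reachable x v := fun h => hnvy (hyx.trans h).symm
    have hF' : graphOf ((insert e₀ (F.erase f) : Finset (Pair n)) : Set (Pair n)) =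
        K ⊔ SimpleGraph.edge x v := by
      ext a b
      rw [SimpleGraph.sup_adj, hK, graphOf_adj, graphOf_adj, SimpleGraph.edge_adj]
      simp only [Finset.coe_insert, Set.mem_insert_iff, he₀, Subtype.mk.injEq, Sym2.eq_iff]
      constructor
      · rintro ⟨h, h' | h'⟩
        · exact Or.inr ⟨h', fun hab => h (Sym2.mk_isDiag_iff.2 hab)⟩
        · exact Or.inl ⟨h, h'⟩
      · rintro (⟨h, h'⟩ | ⟨h, h'⟩)
        · exact ⟨h, Or.inr h'⟩
        · exact ⟨fun hd => h' (Sym2.mk_isDiag_iff.1 hd), Or.inl h⟩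
    have hvx' : (K ⊔ SimpleGraph.edge x v).Reachable v x := by
      apply SimpleGraph.Adj.reachable
      rw [SimpleGraph.sup_adj, SimpleGraph.edge_adj]
      exact Or.inr ⟨Or.inr ⟨rfl, rfl⟩, hvx⟩
    have hsf : IsSpanningForest G (insert e₀ (F.erase f)) := by
      refine ⟨?_, ?_, ?_⟩
      · intro e he
        rw [Finset.mem_coe, Finset.mem_insert, Finset.mem_erase] at he
        rcases he with rfl | ⟨-, he⟩
        · simp [edges, h0]
        · exact hFG he
      · rw [hF']
        exact SimpleGraph.IsAcyclic.sup_edge_of_not_reachable hnxv (hac.anti hKH)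
      · intro a b hab
        rw [hF']
        refine reachable_of_forall_adj (fun c d hcd => ?_) (hspan a b hab)
        by_cases hcdf : s(c, d) = s(v, y)
        · have hvy' : (K ⊔ SimpleGraph.edge x v).Reachable v y :=
            hvx'.trans (hyx.mono le_sup_left).symm
          rcases Sym2.eq_iff.1 hcdf with ⟨rfl, rfl⟩ | ⟨rfl, rfl⟩
          · exact hvy'
          · exact hvy'.symm
        · exact SimpleGraph.Adj.reachable (Or.inl (hadjK c d hcd hcdf))
    have hle := hmin _ hsf
    have he₀' : e₀ ∉ F.erase f := fun h => hnot (Finset.mem_of_mem_erase h)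
    unfold weight at hle
    rw [Finset.sum_insert he₀', ← Finset.add_sum_erase F _ hfF, h0] at hle
    have hfz : G f ≠ some 0 := hz f (Sym2.mem_mk_left v y) hfne
    have hfn : G f ≠ none := hFG hfF
    cases hGf : G f with
    | none => exact hfn hGf
    | some w =>
      have hw : w ≠ 0 := fun h => hfz (by rw [hGf, h])
      have hw' : (w : ℕ) ≠ 0 := fun h => hw (Fin.ext h)
      rw [hGf] at hle
      simp only [Option.elim_some, Fin.val_zero] at hle
      omega

/-- The paths through `x` and through `y` would be two different paths from `a` to `b`. -/
theorem not_isAcyclic_of_four_cycle {V : Type*} {H : SimpleGraph V} (hH : H.IsAcyclic)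
    {a b x y : V} (hab : a ≠ b) (hxy : x ≠ y) (hax : H.Adj a x) (hbx : H.Adj b x)
    (hay : H.Adj a y) (hby : H.Adj b y) : False := by
  have hp : ∀ z (haz : H.Adj a z) (hbz : H.Adj b z),
      (SimpleGraph.Walk.cons haz (SimpleGraph.Walk.cons hbz.symm SimpleGraph.Walk.nil)).IsPath := by
    intro z haz hbz
    simp [SimpleGraph.Walk.cons_isPath_iff, haz.ne, hbz.ne.symm, hab]
  have h := (hH.subsingleton_path a b).elim ⟨_, hp x hax hbx⟩ ⟨_, hp y hay hby⟩
  have h' := congrArg (fun p : H.Path a b => p.1.support) h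
  simp at h'
  exact hxy h'

end Forests

/-! ### The hard sequences of batches -/

variable {k n W B m L N : ℕ}

/-- The batch that toggles the presence of the edges in `T`; edges that become present get the weights
prescribed by `wt`. -/
def toggleBatch (G : WGraph n W) (T : Finset (Pair n)) (wt : Pair n → Fin (W + 1)) : Batch n W :=
  open Classical in
  fun e => if e ∈ T then
    (if G e = none then some (Update.insert (wt e)) else some Update.delete) else none

/-! ### Effect of toggling a set of pairs -/

section Toggle

variable {G : WGraph n W} {T : Finset (Pair n)} {wt : Pair n → Fin (W + 1)} {e : Pair n}

theorem toggleBatch_ne_none : toggleBatch G T wt e ≠ none ↔ e ∈ T := by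
  classical
  unfold toggleBatch
  split_ifs <;> simp_all

theorem validBatch_toggleBatch : ValidBatch G (toggleBatch G T wt) := by
  intro e
  unfold toggleBatch
  constructor
  · intro w h
    split_ifs at h with h1 h2
    · exact h2
    · simp at h
  · intro h
    split_ifs at h with h1 h2
    · simp at h
    · exact h2

theorem batchSize_toggleBatch : batchSize (toggleBatch G T wt) = T.card := by
  unfold batchSize
  simp only [toggleBatch_ne_none]
  exact Set.ncard_coe_finset T

theorem applyBatch_toggleBatch_of_notMem (h : e ∉ T) :
    applyBatch G (toggleBatch G T wt) e = G e := by
  simp [applyBatch, toggleBatch, h]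

theorem applyBatch_toggleBatch_of_none (h : e ∈ T) (hG : G e = none) :
    applyBatch G (toggleBatch G T wt) e = some (wt e) := by
  simp [applyBatch, toggleBatch, h, hG]

theorem applyBatch_toggleBatch_of_ne_none (h : e ∈ T) (hG : G e ≠ none) :
    applyBatch G (toggleBatch G T wt) e = none := by
  simp [applyBatch, toggleBatch, h, hG]

end Toggle

/-- Two hubs and `L` leaves, all distinct. -/
structure Gadget (n L : ℕ) where
  hub : Bool → Fin n
  leaf : Fin L → Fin n
  hub_inj : Function.Injective hub
  leaf_inj : Function.Injective leaf
  hub_ne_leaf : ∀ c i, hub c ≠ leaf i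

/-- A bit for each batch, each leaf and each hub. -/
abbrev Bits (m L : ℕ) : Type := (Fin m × Fin L) × Bool → Bool

namespace Gadget

variable (Γ : Gadget n L)

/-- The pair consisting of a leaf and a hub. -/
def spoke (i : Fin L) (c : Bool) : Pair n :=
  ⟨s(Γ.hub c, Γ.leaf i), fun h => Γ.hub_ne_leaf c i (Sym2.mk_isDiag_iff.1 h)⟩

theorem spoke_inj {i i' : Fin L} {c c' : Bool} (h : Γ.spoke i c = Γ.spoke i' c') :
    i = i' ∧ c = c' := by
  have h' := congrArg Subtype.val h
  rcases Sym2.eq_iff.1 h' with ⟨h1, h2⟩ | ⟨h1, -⟩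
  · exact ⟨Γ.leaf_inj h2, Γ.hub_inj h1⟩
  · exact absurd h1 (Γ.hub_ne_leaf c i')

/-- The set of all spokes. -/
def spokes : Finset (Pair n) :=
  open Classical in Finset.univ.image fun p : Fin L × Bool => Γ.spoke p.1 p.2

theorem mem_spokes {e : Pair n} : e ∈ Γ.spokes ↔ ∃ i c, Γ.spoke i c = e := by
  simp [spokes]

theorem spoke_mem_spokes (i : Fin L) (c : Bool) : Γ.spoke i c ∈ Γ.spokes :=
  Γ.mem_spokes.2 ⟨i, c, rfl⟩

theorem card_spokes : Γ.spokes.card = 2 * L := by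
  classical
  unfold spokes
  rw [Finset.card_image_of_injective]
  · simp [mul_comm]
  · rintro ⟨i, c⟩ ⟨i', c'⟩ h
    obtain ⟨rfl, rfl⟩ := Γ.spoke_inj h
    rfl

/-- The weight with which a pair is inserted in batch `j`: zero for the spokes whose bit is set, and
one for all other pairs. -/
def bitWeight (W : ℕ) (b : Bits m L) (j : ℕ) (e : Pair n) : Fin (W + 1) :=
  open Classical in
  if ∃ p : (Fin m × Fin L) × Bool, (p.1.1 : ℕ) = j ∧ Γ.spoke p.1.2 p.2 = e ∧ b p = true
  then 0 else 1

/-- For `W = 0` the numeral 1 would wrap around to 0; `W ≥ 1` makes the two weights distinct. -/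
theorem one_ne_zero_of_le (hW : 1 ≤ W) : (1 : Fin (W + 1)) ≠ 0 := by
  obtain ⟨W, rfl⟩ := Nat.exists_eq_add_of_le' hW
  simp

theorem bitWeight_spoke_eq_zero (hW : 1 ≤ W) {b : Bits m L} {j : Fin m} {i : Fin L} {c : Bool} :
    Γ.bitWeight W b j (Γ.spoke i c) = 0 ↔ b ((j, i), c) = true := by
  unfold bitWeight
  constructor
  · intro h
    split_ifs at h with h'
    · obtain ⟨⟨⟨j', i'⟩, c'⟩, h1, h2, h3⟩ := h'
      obtain ⟨rfl, rfl⟩ := Γ.spoke_inj h2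
      obtain rfl : j' = j := Fin.ext h1
      exact h3
    · exact absurd h (one_ne_zero_of_le hW)
  · intro h
    exact if_pos ⟨((j, i), c), rfl, rfl, h⟩

theorem bitWeight_of_notMem {b : Bits m L} {j : ℕ} {e : Pair n} (he : e ∉ Γ.spokes) :
    Γ.bitWeight W b j e = 1 :=
  if_neg fun ⟨_, _, h, _⟩ => he (Γ.mem_spokes.2 ⟨_, _, h⟩)

theorem bitWeight_congr {b b' : Bits m L} {j : ℕ} {e : Pair n}
    (h : ∀ p : (Fin m × Fin L) × Bool, (p.1.1 : ℕ) = j → Γ.spoke p.1.2 p.2 = e → b p = b' p) :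
    Γ.bitWeight W b j e = Γ.bitWeight W b' j e := by
  unfold bitWeight
  congr 1
  apply propext
  refine exists_congr fun p => ?_
  constructor
  · rintro ⟨h1, h2, h3⟩; exact ⟨h1, h2, h p h1 h2 ▸ h3⟩
  · rintro ⟨h1, h2, h3⟩; exact ⟨h1, h2, (h p h1 h2).symm ▸ h3⟩

variable (G₀ : WGraph n W) (T : ℕ → Finset (Pair n))

/-- The graph after `j` batches: batch `j` toggles the pairs in `T j`, with weights given by the bits
`b`. -/
def hardGraph (b : Bits m L) : ℕ → WGraph n W
  | 0 => G₀
  | j + 1 => applyBatch (hardGraph b j) (toggleBatch (hardGraph b j) (T j) (Γ.bitWeight W b j))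

/-- The sequence of batches given by the bits `b`. -/
def hardSeq (b : Bits m L) : Fin m → Batch n W := fun j =>
  toggleBatch (Γ.hardGraph G₀ T b j) (T j) (Γ.bitWeight W b j)

theorem graphAfter_hardSeq (b : Bits m L) {j : ℕ} (hj : j ≤ m) :
    graphAfter G₀ (Γ.hardSeq G₀ T b) j = Γ.hardGraph G₀ T b j := by
  induction j with
  | zero => rfl
  | succ j ih => rw [graphAfter, dif_pos (by omega), ih (by omega)]; rfl

theorem validSeq_hardSeq (hT : ∀ j, (T j).card = N) (b : Bits m L) :
    ValidSeq G₀ N (Γ.hardSeq G₀ T b) := by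
  intro j
  rw [graphAfter_hardSeq _ _ _ _ j.2.le]
  exact ⟨validBatch_toggleBatch, batchSize_toggleBatch.trans (hT j)⟩

/-- Bits affect weights, never presence. So whether a toggle inserts or deletes reveals nothing
about them, and an entry of a batch depends only on the bit of that batch and spoke, although it is
defined through the current graph. -/
theorem hardGraph_eq_none_congr (b b' : Bits m L) (j : ℕ) (e : Pair n) :
    Γ.hardGraph G₀ T b j e = none ↔ Γ.hardGraph G₀ T b' j e = none := by
  induction j with
  | zero => rfl
  | succ j ih =>
    have key : ∀ b : Bits m L, Γ.hardGraph G₀ T b (j + 1) e = none ↔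
        ((e ∈ T j) ↔ Γ.hardGraph G₀ T b j e ≠ none) := by
      intro b
      rw [hardGraph]
      by_cases he : e ∈ T j
      · by_cases hg : Γ.hardGraph G₀ T b j e = none
        · rw [applyBatch_toggleBatch_of_none he hg]
          simp [he, hg]
        · rw [applyBatch_toggleBatch_of_ne_none he hg]
          simp [he, hg]
      · rw [applyBatch_toggleBatch_of_notMem he]
        simp [he]
    rw [key, key, ne_eq, ih]

theorem hardSeq_congr {b b' : Bits m L} {j : Fin m} {e : Pair n}
    (h : ∀ p : (Fin m × Fin L) × Bool, p.1.1 = j → Γ.spoke p.1.2 p.2 = e → b p = b' p) :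
    Γ.hardSeq G₀ T b j e = Γ.hardSeq G₀ T b' j e := by
  unfold hardSeq toggleBatch
  rw [Γ.bitWeight_congr fun p h1 h2 => h p (Fin.ext h1) h2]
  simp only [Γ.hardGraph_eq_none_congr G₀ T b b' j e]

/-! ### Presence and weights of the spokes along the sequence -/

section Spokes

variable {G₀ T}

/-- Batch `0` removes exactly the spokes present in `G₀`; from then on every batch toggles all of
them. Hence the batches of odd index, counted from zero, are the insertions. -/
theorem hardGraph_odd (hT₀ : ∀ e ∈ Γ.spokes, (e ∈ T 0 ↔ G₀ e ≠ none))
    (hT : ∀ j, Γ.spokes ⊆ T (j + 1)) (b : Bits m L) {e : Pair n} (he : e ∈ Γ.spokes) (i : ℕ) :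
    Γ.hardGraph G₀ T b (2 * i + 1) e = none := by
  induction i with
  | zero =>
    change applyBatch G₀ (toggleBatch G₀ (T 0) (Γ.bitWeight W b 0)) e = none
    by_cases h : G₀ e = none
    · rw [applyBatch_toggleBatch_of_notMem (by simpa using (hT₀ e he).not.2 (by simpa using h))]
      exact h
    · rw [applyBatch_toggleBatch_of_ne_none ((hT₀ e he).2 h) h]
  | succ i ih =>
    have h1 : Γ.hardGraph G₀ T b (2 * i + 1 + 1) e ≠ none := by
      rw [hardGraph, applyBatch_toggleBatch_of_none (hT _ he) ih]
      simp
    rw [show 2 * (i + 1) + 1 = (2 * i + 1) + 1 + 1 by ring, hardGraph,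
      applyBatch_toggleBatch_of_ne_none (hT _ he) h1]

theorem hardGraph_even_spoke (hT₀ : ∀ e ∈ Γ.spokes, (e ∈ T 0 ↔ G₀ e ≠ none))
    (hT : ∀ j, Γ.spokes ⊆ T (j + 1)) (b : Bits m L) {e : Pair n} (he : e ∈ Γ.spokes) (i : ℕ) :
    Γ.hardGraph G₀ T b (2 * i + 1 + 1) e = some (Γ.bitWeight W b (2 * i + 1) e) := by
  rw [hardGraph, applyBatch_toggleBatch_of_none (hT _ he) (Γ.hardGraph_odd hT₀ hT b he i)]

/-- Positive initial weights and filler weight 1 ensure that nothing but a spoke can be a zero edge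
at a leaf. -/
theorem hardGraph_ne_zero (hW : 1 ≤ W) (hG₀ : ∀ e w, G₀ e = some w → 0 < w) (b : Bits m L)
    {e : Pair n} (he : e ∉ Γ.spokes) (j : ℕ) : Γ.hardGraph G₀ T b j e ≠ some 0 := by
  induction j with
  | zero => exact fun h => lt_irrefl _ (hG₀ e 0 h)
  | succ j ih =>
    rw [hardGraph]
    by_cases h : e ∈ T j
    · by_cases hg : Γ.hardGraph G₀ T b j e = none
      · rw [applyBatch_toggleBatch_of_none h hg, Γ.bitWeight_of_notMem he]
        simpa using one_ne_zero_of_le hW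
      · rw [applyBatch_toggleBatch_of_ne_none h hg]
        simp
    · rwa [applyBatch_toggleBatch_of_notMem h]

end Spokes

/-- Sets of pairs to be toggled, with prescribed number of elements and containing all spokes. -/
theorem exists_toggle_sets (G₀ : WGraph n W) (hN : 2 * L ≤ N) (hn : N + 2 * L ≤ n.choose 2) :
    ∃ T : ℕ → Finset (Pair n), (∀ j, (T j).card = N) ∧
      (∀ e ∈ Γ.spokes, (e ∈ T 0 ↔ G₀ e ≠ none)) ∧ ∀ j, Γ.spokes ⊆ T (j + 1) := by
  classical
  have hcard : Fintype.card (Pair n) = n.choose 2 := by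
    have := Sym2.card_subtype_not_diag (α := Fin n)
    rw [Fintype.card_fin] at this
    rw [← this]
  -- Any set of spokes can be filled up to size `N` by non-spokes. It is applied to the spokes
  -- present in `G₀` for batch `0` and to all spokes for the later batches.
  have key : ∀ S ⊆ Γ.spokes, ∃ T : Finset (Pair n), T.card = N ∧ ∀ e ∈ Γ.spokes, (e ∈ T ↔ e ∈ S) := by
    intro S hS
    have hSc : S.card ≤ 2 * L := Γ.card_spokes ▸ Finset.card_le_card hS
    have hc : N - S.card ≤ (Γ.spokesᶜ).card := by
      rw [Finset.card_compl, Γ.card_spokes, hcard]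
      omega
    obtain ⟨Q, hQ, hQc⟩ := Finset.exists_subset_card_eq hc
    have hd : ∀ e ∈ Q, e ∉ Γ.spokes := fun e he => Finset.mem_compl.1 (hQ he)
    refine ⟨S ∪ Q, ?_, fun e he => ?_⟩
    · rw [Finset.card_union_of_disjoint, hQc]
      · omega
      · exact Finset.disjoint_left.2 fun e he he' => hd e he' (hS he)
    · rw [Finset.mem_union]
      exact ⟨fun h => h.resolve_right fun h' => hd e h' he, Or.inl⟩
  obtain ⟨T₀, h1, h2⟩ := key (Γ.spokes.filter fun e => G₀ e ≠ none) (Finset.filter_subset _ _)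
  obtain ⟨T₁, h3, h4⟩ := key Γ.spokes subset_rfl
  refine ⟨fun j => if j = 0 then T₀ else T₁, fun j => ?_, fun e he => ?_, fun j e he => ?_⟩
  · dsimp only
    split_ifs <;> assumption
  · change e ∈ T₀ ↔ _
    rw [h2 e he, Finset.mem_filter, and_iff_right he]
  · change e ∈ T₁
    exact (h4 e he).2 he

/-! ### What a minimum spanning forest reveals about the bits -/

section Forest

variable {G₀ T}

/-- In a minimum spanning forest, the spoke from a leaf to one hub belongs to the forest if its bit
is set and the bit of the other spoke of the leaf is not. -/
theorem other_bit_of_notMem (hT₀ : ∀ e ∈ Γ.spokes, (e ∈ T 0 ↔ G₀ e ≠ none))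
    (hT : ∀ j, Γ.spokes ⊆ T (j + 1)) (hW : 1 ≤ W) (hG₀ : ∀ e w, G₀ e = some w → 0 < w)
    {b : Bits m L} {j : Fin m} (hj : Odd (j : ℕ)) {F : Finset (Pair n)}
    (hF : IsMSF (Γ.hardGraph G₀ T b (j + 1)) F) {i : Fin L} {c : Bool}
    (hb : b ((j, i), c) = true) (hnot : Γ.spoke i c ∉ F) : b ((j, i), !c) = true := by
  obtain ⟨r, hr⟩ := hj
  have hsp : ∀ i c, Γ.hardGraph G₀ T b (j + 1) (Γ.spoke i c) = some 0 ↔ b ((j, i), c) = true := by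
    intro i c
    have h := Γ.hardGraph_even_spoke hT₀ hT b (Γ.spoke_mem_spokes i c) r
    rw [← hr] at h
    rw [h, Option.some_inj]
    exact Γ.bitWeight_spoke_eq_zero hW
  by_contra hb'
  refine hnot (hF.mem_of_unique_zero _ ((hsp i c).2 hb) fun e hie hne h0 => ?_)
  by_cases he : e ∈ Γ.spokes
  · obtain ⟨i', c', rfl⟩ := Γ.mem_spokes.1 he
    have hi : i = i' := by
      rcases Sym2.mem_iff.1 hie with h | h
      · exact absurd h.symm (Γ.hub_ne_leaf c' i)
      · exact Γ.leaf_inj h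
    subst hi
    have hc : c' ≠ c := fun h => hne (by rw [h]; rfl)
    have hc' : c' = !c := by cases c <;> cases c' <;> simp_all
    subst hc'
    exact hb' ((hsp _ _).1 h0)
  · exact Γ.hardGraph_ne_zero hW hG₀ b he _ h0

/-- Two such leaves would form a 4-cycle with the hubs. So all but one of the leaves with both bits
set have a zero spoke outside the forest, which reveals a bit. -/
theorem eq_of_four_spokes_mem {G : WGraph n W} {F : Finset (Pair n)} (hF : IsMSF G F)
    {i i' : Fin L} (h : ∀ c, Γ.spoke i c ∈ F) (h' : ∀ c, Γ.spoke i' c ∈ F) : i = i' := by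
  by_contra hne
  have hadj : ∀ i c, Γ.spoke i c ∈ F → (graphOf (F : Set (Pair n))).Adj (Γ.hub c) (Γ.leaf i) :=
    fun i c hi => graphOf_adj.2 ⟨(Γ.spoke i c).2, hi⟩
  exact not_isAcyclic_of_four_cycle hF.1.2.1 (Γ.hub_inj.ne Bool.false_ne_true)
    (Γ.leaf_inj.ne hne) (hadj _ _ (h _)) (hadj _ _ (h _)) (hadj _ _ (h' _)) (hadj _ _ (h' _))

end Forest

end Gadget

/-! ### Executions of protocols -/

variable {k n W B m : ℕ}

instance : Finite (Message B) := (finite_and_card_lists_le Bool B).1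

theorem card_message_le (B : ℕ) : Nat.card (Message B) ≤ 3 ^ B := by
  simpa using (finite_and_card_lists_le Bool B).2

instance : Finite (Update W) :=
  Finite.of_injective
    (fun u : Update W => match u with
      | Update.insert w => some w
      | Update.delete => (none : Option (Fin (W + 1))))
    (by rintro (w | _) (w' | _) h <;> simp_all)

instance : Finite (Event k n W B) :=
  Finite.of_injective
    (fun u : Event k n W B => match u with
      | Event.batch b => (Sum.inl b : Batch n W ⊕ (Fin k → Message B))
      | Event.round x => Sum.inr x)
    (by rintro (w | _) (w' | _) h <;> simp_all)

namespace Protocol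

variable (P : Protocol k n W B) (π : Fin n → Fin k) (G₀ : WGraph n W)

theorem iterate_step_eq_append (c : Config k n W B) (r : ℕ) (i : Fin k) :
    ∃ l : List (Fin k → Message B), l.length = r ∧
      (P.step π G₀)^[r] c i = c i ++ l.map Event.round := by
  induction r with
  | zero => exact ⟨[], rfl, by simp⟩
  | succ r ih =>
    obtain ⟨l, hl, h⟩ := ih
    refine ⟨l ++ [fun j => P.send (view π G₀ ((P.step π G₀)^[r] c) j) i], by simp [hl], ?_⟩
    rw [Function.iterate_succ_apply', step, h]
    simp

theorem run_eq_none {c : Config k n W B} :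
    P.run π G₀ c = none ↔ ∀ r, ¬ P.AllFinished π G₀ ((P.step π G₀)^[r] c) := by
  unfold run
  split_ifs with h
  · simpa using h
  · simpa using h

theorem run_eq_some {c : Config k n W B} {s : ℕ × Config k n W B} :
    P.run π G₀ c = some s ↔ P.AllFinished π G₀ ((P.step π G₀)^[s.1] c) ∧
      (∀ r < s.1, ¬ P.AllFinished π G₀ ((P.step π G₀)^[r] c)) ∧ (P.step π G₀)^[s.1] c = s.2 := by
  classical
  obtain ⟨r, c'⟩ := s
  unfold run
  split_ifs with h
  · rw [Option.some_inj, Prod.mk.injEq, Nat.find_eq_iff]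
    constructor
    · rintro ⟨⟨h1, h2⟩, h3⟩
      have hr := (Nat.find_eq_iff h).2 ⟨h1, h2⟩
      rw [hr] at h3
      exact ⟨h1, h2, h3⟩
    · rintro ⟨h1, h2, h3⟩
      have hr := (Nat.find_eq_iff h).2 ⟨h1, h2⟩
      rw [hr]
      exact ⟨⟨h1, h2⟩, h3⟩
  · simp only [false_iff]
    exact fun h' => h ⟨r, h'.1⟩

theorem stage_congr {bs bs' : Fin m → Batch n W} {j : ℕ}
    (h : ∀ i : Fin m, (i : ℕ) < j → bs i = bs' i) : P.stage π G₀ bs j = P.stage π G₀ bs' j := by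
  induction j with
  | zero => rfl
  | succ j ih =>
    unfold stage
    rw [ih fun i hi => h i (by omega)]
    split_ifs with hj
    · rw [h ⟨j, hj⟩ (Nat.lt_succ_self j)]
    · rfl

/-- The observations of a machine at the end of a stage are those at the end of the previous stage,
the batch, and one collection of messages for each round. -/
theorem exists_log_of_stage_succ {bs : Fin m → Batch n W} {j : Fin m} {s : ℕ × Config k n W B}
    (h : P.stage π G₀ bs (j + 1) = some s) (i : Fin k) :
    ∃ s₀ : ℕ × Config k n W B, P.stage π G₀ bs j = some s₀ ∧
      ∃ l : List (Fin k → Message B), l.length = s.1 ∧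
        s.2 i = s₀.2 i ++ [Event.batch (localPart π i (bs j))] ++ l.map Event.round := by
  rw [stage, dif_pos j.2, Option.bind_eq_some_iff] at h
  obtain ⟨s₀, h0, h⟩ := h
  obtain ⟨-, -, h⟩ := (P.run_eq_some π G₀).1 h
  obtain ⟨l, hl, h'⟩ := P.iterate_step_eq_append π G₀ (deliver π (bs j) s₀.2) s.1 i
  refine ⟨s₀, h0, l, hl, ?_⟩
  rw [← h]
  exact h'

end Protocol

/-! ### Measurability -/

section Measurability

/-- Configurations are finite families of lists over a finite type of events, hence countable.
Events about an execution therefore split over its possible values, and their measurability reduces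
to that of the single decisions of the protocol. -/
theorem measurableSet_of_countable {Ω α : Type*} [MeasurableSpace Ω] [Countable α] {f : Ω → α}
    (hf : ∀ a, MeasurableSet {ω | f ω = a}) {Q : α → Ω → Prop}
    (hQ : ∀ a, MeasurableSet {ω | Q a ω}) : MeasurableSet {ω | Q (f ω) ω} := by
  have : {ω | Q (f ω) ω} = ⋃ a, {ω | f ω = a} ∩ {ω | Q a ω} := by
    ext ω
    simp
  rw [this]
  exact MeasurableSet.iUnion fun a => (hf a).inter (hQ a)

namespace Algorithm

variable (A : Algorithm k n W B) (π : Fin n → Fin k) (G₀ : WGraph n W)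

theorem measurableSet_step (c c' : Config k n W B) :
    MeasurableSet {ω | (A.proto ω).step π G₀ c = c'} := by
  have : {ω | (A.proto ω).step π G₀ c = c'} =
      ⋂ i, {ω | c i ++ [Event.round (fun j => (A.proto ω).send (Protocol.view π G₀ c j) i)] =
        c' i} := by
    ext ω
    simp [funext_iff, Protocol.step]
  rw [this]
  refine MeasurableSet.iInter fun i => ?_
  refine measurableSet_of_countable
    (f := fun ω j => (A.proto ω).send (Protocol.view π G₀ c j) i)
    (Q := fun x _ => c i ++ [Event.round x] = c' i) (fun x => ?_) (fun _ => MeasurableSet.const _)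
  simp only [funext_iff, Set.ofPred_forall]
  exact MeasurableSet.iInter fun j => A.measurable_send _ _ _

theorem measurableSet_iterate_step (c : Config k n W B) (r : ℕ) (c' : Config k n W B) :
    MeasurableSet {ω | ((A.proto ω).step π G₀)^[r] c = c'} := by
  induction r generalizing c' with
  | zero => exact MeasurableSet.const (c = c')
  | succ r ih =>
    simp only [Function.iterate_succ_apply']
    exact measurableSet_of_countable (f := fun ω => ((A.proto ω).step π G₀)^[r] c)
      (Q := fun x ω => (A.proto ω).step π G₀ x = c') ih fun x => A.measurableSet_step π G₀ x c'

theorem measurableSet_allFinished (c : Config k n W B) (r : ℕ) :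
    MeasurableSet {ω | (A.proto ω).AllFinished π G₀ (((A.proto ω).step π G₀)^[r] c)} := by
  refine measurableSet_of_countable (f := fun ω => ((A.proto ω).step π G₀)^[r] c)
    (Q := fun x ω => (A.proto ω).AllFinished π G₀ x) (A.measurableSet_iterate_step π G₀ c r)
    fun x => ?_
  simp only [Protocol.AllFinished, Set.ofPred_forall]
  exact MeasurableSet.iInter fun i => A.measurable_finished _

theorem measurableSet_run (c : Config k n W B) (x : Option (ℕ × Config k n W B)) :
    MeasurableSet {ω | (A.proto ω).run π G₀ c = x} := by
  cases x with
  | none =>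
    simp only [Protocol.run_eq_none, Set.ofPred_forall]
    exact MeasurableSet.iInter fun r => (A.measurableSet_allFinished π G₀ c r).compl
  | some s =>
    simp only [Protocol.run_eq_some, Set.ofPred_and, Set.ofPred_forall]
    exact (A.measurableSet_allFinished π G₀ c _).inter
      ((MeasurableSet.iInter fun r => MeasurableSet.iInter fun _ =>
        (A.measurableSet_allFinished π G₀ c r).compl).inter
        (A.measurableSet_iterate_step π G₀ c _ _))

theorem measurableSet_stage (bs : Fin m → Batch n W) (j : ℕ) (x : Option (ℕ × Config k n W B)) :
    MeasurableSet {ω | (A.proto ω).stage π G₀ bs j = x} := by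
  induction j generalizing x with
  | zero => exact A.measurableSet_run π G₀ _ _
  | succ j ih =>
    unfold Protocol.stage
    by_cases hj : j < m
    · simp only [hj, dif_pos]
      refine measurableSet_of_countable (f := fun ω => (A.proto ω).stage π G₀ bs j)
        (Q := fun y ω => y.bind (fun s =>
          (A.proto ω).run π G₀ (Protocol.deliver π (bs ⟨j, hj⟩) s.2)) = x) ih fun y => ?_
      cases y with
      | none => exact MeasurableSet.const (none = x)
      | some s => exact A.measurableSet_run π G₀ _ _
    · simp only [hj, dif_neg, not_false_eq_true]
      exact MeasurableSet.const _

theorem measurable_batchRounds (bs : Fin m → Batch n W) (j : Fin m) :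
    Measurable fun ω => (A.proto ω).batchRounds π G₀ bs j := by
  intro s _
  exact measurableSet_of_countable (f := fun ω => (A.proto ω).stage π G₀ bs (j + 1))
    (Q := fun y _ => (match y with
      | some s => (s.1 : ℝ≥0∞)
      | none => ⊤) ∈ s) (A.measurableSet_stage π G₀ bs _) fun _ => MeasurableSet.const _

theorem measurableSet_batchCorrect (bs : Fin m → Batch n W) (j : Fin m) :
    MeasurableSet {ω | (A.proto ω).BatchCorrect π G₀ bs j} := by
  refine measurableSet_of_countable (f := fun ω => (A.proto ω).stage π G₀ bs (j + 1))
    (Q := fun y ω => ∃ s, y = some s ∧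
      (A.proto ω).OutputCorrect π G₀ s.2 (graphAfter G₀ bs (j + 1)))
    (A.measurableSet_stage π G₀ bs _) fun y => ?_
  simp only [Protocol.OutputCorrect, Set.ofPred_exists, Set.ofPred_and, Set.ofPred_forall]
  refine MeasurableSet.iUnion fun s => (MeasurableSet.const _).inter <|
    MeasurableSet.iUnion fun F => (MeasurableSet.const _).inter <| MeasurableSet.iInter fun i =>
      MeasurableSet.iInter fun e => MeasurableSet.iInter fun _ => MeasurableSet.iInter fun _ => ?_
  by_cases he : e ∈ F
  · simp only [he, iff_true]
    exact A.measurable_output _ _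
  · simp only [he, iff_false]
    exact (A.measurable_output _ _).compl

end Algorithm

end Measurability

/-! ### A single insertion batch of the hard sequence -/

variable {k n W B m L N : ℕ}

namespace Gadget

variable (Γ : Gadget n L)

/-- The leaves that are not hosted together with a hub. -/
def freeLeaves (π : Fin n → Fin k) : Finset (Fin L) :=
  Finset.univ.filter fun i => ∀ c, π (Γ.hub c) ≠ π (Γ.leaf i)

/-- The two hubs are hosted by different machines, and at least half of the leaves are free. -/
def GoodPartition (π : Fin n → Fin k) : Prop :=
  π (Γ.hub false) ≠ π (Γ.hub true) ∧ L ≤ 2 * (Γ.freeLeaves π).card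

theorem GoodPartition.hub_ne {Γ : Gadget n L} {π : Fin n → Fin k} (h : Γ.GoodPartition π) (c : Bool) :
    π (Γ.hub !c) ≠ π (Γ.hub c) := by
  cases c
  · exact h.1.symm
  · exact h.1

/-- The bits of batch `j` that the machine hosting the hub `c` does not see: those of the spokes from
free leaves to the other hub. -/
def hiddenBits (π : Fin n → Fin k) (j : Fin m) (c : Bool) : Finset ((Fin m × Fin L) × Bool) :=
  (Γ.freeLeaves π).image fun i => ((j, i), !c)

theorem card_image_free (s : Finset (Fin L)) (j : Fin m) (c : Bool) :
    (s.image fun i => ((j, i), c)).card = s.card :=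
  Finset.card_image_of_injective _ fun i i' h => by simpa using h

variable (P : Protocol k n W B) (π : Fin n → Fin k) (G₀ : WGraph n W) (T : ℕ → Finset (Pair n))

/-- The observations of a machine before the messages of batch `j`. -/
def logAtArrival (b : Bits m L) (j : Fin m) (a : Fin k) : List (Event k n W B) :=
  -- The default `[]` is harmless: if batch `j` is completed, then so is the previous stage.
  (P.stage π G₀ (Γ.hardSeq G₀ T b) j).elim [] (fun s => s.2 a) ++
    [Event.batch (localPart π a (Γ.hardSeq G₀ T b j))]

/-- The hidden bits that the machine hosting the hub `c` claims to be set if it has received the messages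
`τ` for batch `j`. -/
def guess (j : Fin m) (c : Bool) (τ : List (Fin k → Message B)) (b : Bits m L) :
    Finset ((Fin m × Fin L) × Bool) :=
  ((Γ.freeLeaves π).filter fun i => b ((j, i), c) = true ∧
    P.output ⟨π (Γ.hub c), π, localPart π (π (Γ.hub c)) G₀,
      Γ.logAtArrival P π G₀ T b j (π (Γ.hub c)) ++ τ.map Event.round⟩ (Γ.spoke i c) = false).image
    fun i => ((j, i), !c)

theorem guess_subset (j : Fin m) (c : Bool) (τ : List (Fin k → Message B)) (b : Bits m L) :
    Γ.guess P π G₀ T j c τ b ⊆ Γ.hiddenBits π j c :=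
  Finset.image_subset_image (Finset.filter_subset _ _)

/-- Earlier batches do not involve the bits of batch `j`, and a hidden spoke joins the other hub to
a free leaf, neither of which is on this machine. With `τ` a fixed parameter, no other dependence on
the hidden bits remains, as `card_guess_mul_le` requires. -/
theorem guess_congr (hπ : Γ.GoodPartition π) (j : Fin m) (c : Bool)
    (τ : List (Fin k → Message B)) {b b' : Bits m L} (h : ∀ p ∉ Γ.hiddenBits π j c, b p = b' p) :
    Γ.guess P π G₀ T j c τ b = Γ.guess P π G₀ T j c τ b' := by
  have hstage : P.stage π G₀ (Γ.hardSeq G₀ T b) j = P.stage π G₀ (Γ.hardSeq G₀ T b') j := by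
    refine P.stage_congr π G₀ fun i hi => funext fun e => Γ.hardSeq_congr G₀ T fun p hp _ => h p ?_
    intro hp'
    obtain ⟨i', -, rfl⟩ := Finset.mem_image.1 hp'
    subst hp
    exact lt_irrefl _ hi
  have hlocal : localPart π (π (Γ.hub c)) (Γ.hardSeq G₀ T b j) =
      localPart π (π (Γ.hub c)) (Γ.hardSeq G₀ T b' j) := by
    funext e
    unfold localPart
    split_ifs with hl
    · refine Γ.hardSeq_congr G₀ T fun p _ hpe => h p ?_
      intro hp
      obtain ⟨i, hi, rfl⟩ := Finset.mem_image.1 hp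
      obtain ⟨v, hv, hvπ⟩ := hl
      rw [← hpe] at hv
      rcases Sym2.mem_iff.1 hv with rfl | rfl
      · exact hπ.hub_ne c hvπ
      · exact (Finset.mem_filter.1 hi).2 c hvπ.symm
    · rfl
  have hbit : ∀ i, b ((j, i), c) = b' ((j, i), c) := fun i => h _ fun hp => by
    obtain ⟨i', -, hi'⟩ := Finset.mem_image.1 hp
    have := congrArg Prod.snd hi'
    simp at this
  unfold guess logAtArrival
  simp only [hstage, hlocal, hbit]

variable {G₀ T}

/-- If batch `j` is processed correctly within `R` rounds, then one of the two hubs guesses many hidden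
bits correctly from at most `R` rounds of messages, or few free leaves have both bits set. -/
theorem exists_guess_of_batchCorrect (hT₀ : ∀ e ∈ Γ.spokes, (e ∈ T 0 ↔ G₀ e ≠ none))
    (hT : ∀ j, Γ.spokes ⊆ T (j + 1)) (hW : 1 ≤ W) (hG₀ : ∀ e w, G₀ e = some w → 0 < w)
    {j : Fin m} (hj : Odd (j : ℕ)) {b : Bits m L} {R : ℕ} (t : ℕ)
    (hc : P.BatchCorrect π G₀ (Γ.hardSeq G₀ T b) j)
    (hR : P.batchRounds π G₀ (Γ.hardSeq G₀ T b) j ≤ R) :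
    (∃ c, ∃ τ : {τ : List (Fin k → Message B) // τ.length ≤ R},
      t ≤ (Γ.guess P π G₀ T j c τ.1 b).card ∧ ∀ p ∈ Γ.guess P π G₀ T j c τ.1 b, b p = true) ∨
    (((Γ.freeLeaves π).image fun i => (j, i)).filter
      fun q => ∀ c, b (q, c) = true).card < 2 * t := by
  classical
  obtain ⟨s, hs, F, hF, hout⟩ := hc
  rw [Γ.graphAfter_hardSeq G₀ T b j.2] at hF hout
  have hsR : s.1 ≤ R := by
    unfold Protocol.batchRounds at hR
    rw [hs] at hR
    change (s.1 : ℝ≥0∞) ≤ R at hR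
    exact_mod_cast hR
  have hτ : ∀ c, ∃ τ : {τ : List (Fin k → Message B) // τ.length ≤ R},
      s.2 (π (Γ.hub c)) = Γ.logAtArrival P π G₀ T b j (π (Γ.hub c)) ++ τ.1.map Event.round := by
    intro c
    obtain ⟨s₀, h0, l, hl, h⟩ := P.exists_log_of_stage_succ π G₀ hs (π (Γ.hub c))
    refine ⟨⟨l, hl.trans_le hsR⟩, ?_⟩
    rw [h, logAtArrival, h0]
    rfl
  choose τ hτ using hτ
  have hmem : ∀ i c, b ((j, i), c) = true →
      (P.output ⟨π (Γ.hub c), π, localPart π (π (Γ.hub c)) G₀,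
        Γ.logAtArrival P π G₀ T b j (π (Γ.hub c)) ++ (τ c).1.map Event.round⟩ (Γ.spoke i c) = true ↔
        Γ.spoke i c ∈ F) := by
    intro i c _
    have hedge : Γ.spoke i c ∈ edges (Γ.hardGraph G₀ T b (j + 1)) := by
      obtain ⟨r, hr⟩ := hj
      have h := Γ.hardGraph_even_spoke hT₀ hT b (Γ.spoke_mem_spokes i c) r
      rw [← hr] at h
      simp [edges, h]
    have h := hout (π (Γ.hub c)) _ hedge ⟨Γ.hub c, Sym2.mem_mk_left _ _, rfl⟩
    rw [← h, ← hτ c]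
    rfl
  let M : Bool → Finset (Fin L) := fun c =>
    (Γ.freeLeaves π).filter fun i => b ((j, i), c) = true ∧ Γ.spoke i c ∉ F
  have hguess : ∀ c, Γ.guess P π G₀ T j c (τ c).1 b = (M c).image fun i => ((j, i), !c) := by
    intro c
    unfold guess
    congr 1
    refine Finset.filter_congr fun i _ => and_congr_right fun hb => ?_
    rw [← hmem i c hb, Bool.not_eq_true]
  by_cases hcard : ∃ c, t ≤ (M c).card
  · obtain ⟨c, ht⟩ := hcard
    refine Or.inl ⟨c, τ c, ?_, ?_⟩
    · rwa [hguess, card_image_free]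
    · intro p hp
      rw [hguess] at hp
      obtain ⟨i, hi, rfl⟩ := Finset.mem_image.1 hp
      obtain ⟨-, hb, hnot⟩ := Finset.mem_filter.1 hi
      exact Γ.other_bit_of_notMem hT₀ hT hW hG₀ hj hF hb hnot
  · refine Or.inr ?_
    push Not at hcard
    rw [Finset.filter_image, Finset.card_image_of_injective _ fun i i' h => by simpa using h]
    -- If both `M c` have fewer than `t` elements, at most `(t - 1) + (t - 1) + 1 < 2 * t` free
    -- leaves have both bits set.
    let D := (Γ.freeLeaves π).filter fun i =>
      (∀ c, b ((j, i), c) = true) ∧ ∀ c, Γ.spoke i c ∈ F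
    have hD : D.card ≤ 1 := Finset.card_le_one.2 fun i hi i' hi' =>
      Γ.eq_of_four_spokes_mem hF (Finset.mem_filter.1 hi).2.2 (Finset.mem_filter.1 hi').2.2
    have hsub : ((Γ.freeLeaves π).filter fun i => ∀ c, b ((j, i), c) = true) ⊆
        M false ∪ M true ∪ D := by
      intro i hi
      obtain ⟨hfree, hb⟩ := Finset.mem_filter.1 hi
      simp only [M, D, Finset.mem_union, Finset.mem_filter]
      by_cases h1 : Γ.spoke i false ∈ F
      · by_cases h2 : Γ.spoke i true ∈ F
        · exact Or.inr ⟨hfree, hb, fun c => by cases c <;> assumption⟩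
        · exact Or.inl (Or.inr ⟨hfree, hb _, h2⟩)
      · exact Or.inl (Or.inl ⟨hfree, hb _, h1⟩)
    have h1 := Finset.card_le_card hsub
    have h2 := Finset.card_union_le (M false ∪ M true) D
    have h3 := Finset.card_union_le (M false) (M true)
    have h4 := hcard false
    have h5 := hcard true
    omega

/-- This is the number of terms in the union bound. A round brings `k` messages, each with at most
`3 ^ B ≤ 4 ^ B` values; a further factor 4 per round absorbs the transcripts with fewer rounds. -/
theorem card_transcripts_le (k B R : ℕ) :
    Nat.card {τ : List (Fin k → Message B) // τ.length ≤ R} ≤ 2 ^ (2 * (B * k + 1) * R) := by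
  refine (finite_and_card_lists_le _ R).2.trans ?_
  rw [pow_mul]
  refine Nat.pow_le_pow_left ?_ R
  rw [Nat.card_fun, Nat.card_fin]
  have h1 : Nat.card (Message B) ^ k ≤ 4 ^ (B * k) := by
    rw [pow_mul]
    exact Nat.pow_le_pow_left ((card_message_le B).trans (Nat.pow_le_pow_left (by norm_num) B)) k
  have h2 : 2 ^ (2 * (B * k + 1)) = 4 * 4 ^ (B * k) := by
    rw [pow_mul, pow_succ]
    norm_num [mul_comm]
  have h3 : 1 ≤ 4 ^ (B * k) := Nat.one_le_pow _ _ (by norm_num)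
  omega

open Classical in
/-- For a good partition and fixed coins, an insertion batch is rarely processed correctly within few
rounds. -/
theorem card_batchCorrect_le (hT₀ : ∀ e ∈ Γ.spokes, (e ∈ T 0 ↔ G₀ e ≠ none))
    (hT : ∀ j, Γ.spokes ⊆ T (j + 1)) (hW : 1 ≤ W) (hG₀ : ∀ e w, G₀ e = some w → 0 < w)
    {j : Fin m} (hj : Odd (j : ℕ)) (hπ : Γ.GoodPartition π) {R t : ℕ} (hL : L = 32 * t)
    (ht : 2 * (B * k + 1) * R + k ≤ t) :
    ((Finset.univ.filter fun b : Bits m L => P.BatchCorrect π G₀ (Γ.hardSeq G₀ T b) j ∧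
        P.batchRounds π G₀ (Γ.hardSeq G₀ T b) j ≤ R).card : ℝ) ≤
      3 * (1 / 2) ^ k * Fintype.card (Bits m L) := by
  have : Finite {τ : List (Fin k → Message B) // τ.length ≤ R} :=
    (finite_and_card_lists_le _ R).1
  have : Fintype {τ : List (Fin k → Message B) // τ.length ≤ R} := Fintype.ofFinite _
  set Ω : ℝ := ((Fintype.card (Bits m L) : ℕ) : ℝ) with hΩ
  have hΩ0 : 0 ≤ Ω := by positivity
  let E : Bool → {τ : List (Fin k → Message B) // τ.length ≤ R} → Finset (Bits m L) := fun c τ =>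
    Finset.univ.filter fun b => t ≤ (Γ.guess P π G₀ T j c τ.1 b).card ∧
      ∀ p ∈ Γ.guess P π G₀ T j c τ.1 b, b p = true
  let S : Finset (Fin m × Fin L) := (Γ.freeLeaves π).image fun i => (j, i)
  let F : Finset (Bits m L) := Finset.univ.filter fun b =>
    (S.filter fun q => ∀ c, b (q, c) = true).card < 2 * t
  have hS : 16 * t ≤ S.card := by
    have h1 : S.card = (Γ.freeLeaves π).card :=
      Finset.card_image_of_injective _ fun i i' h => by simpa using h
    have h2 := hπ.2
    omega
  have hE : ∀ c τ, ((E c τ).card : ℝ) ≤ (1 / 2) ^ t * Ω := by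
    intro c τ
    have h := card_guess_mul_le (Γ.hiddenBits π j c) (Γ.guess P π G₀ T j c τ.1)
      (Γ.guess_subset P π G₀ T j c τ.1) (fun b b' h => Γ.guess_congr P π G₀ T hπ j c τ.1 h) t
    have h' : ((E c τ).card : ℝ) * 2 ^ t ≤ Ω := by
      rw [hΩ]
      exact_mod_cast h
    rw [one_div, inv_pow, inv_mul_eq_div, le_div_iff₀ (by positivity)]
    exact h'
  -- The constant 32 in `L = 32 * t` comes from here: at least `16 * t` leaves are free, and `2 ^ 2
  -- * (7 / 8) ^ 16 ≤ 1 / 2`.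
  have hF : (F.card : ℝ) ≤ (1 / 2) ^ t * Ω := by
    refine (card_few_both_true_le S (2 * t)).trans ?_
    refine mul_le_mul_of_nonneg_right ?_ hΩ0
    calc (2 : ℝ) ^ (2 * t) * (7 / 8) ^ S.card ≤ 2 ^ (2 * t) * (7 / 8) ^ (16 * t) := by
          refine mul_le_mul_of_nonneg_left ?_ (by positivity)
          exact pow_le_pow_of_le_one (by norm_num) (by norm_num) hS
      _ = (2 ^ 2 * (7 / 8) ^ 16) ^ t := by rw [mul_pow, ← pow_mul, ← pow_mul]
      _ ≤ (1 / 2) ^ t := pow_le_pow_left₀ (by positivity) (by norm_num) t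
  have hsub : (Finset.univ.filter fun b : Bits m L => P.BatchCorrect π G₀ (Γ.hardSeq G₀ T b) j ∧
        P.batchRounds π G₀ (Γ.hardSeq G₀ T b) j ≤ R) ⊆
      (Finset.univ.biUnion fun x : Bool × _ => E x.1 x.2) ∪ F := by
    intro b hb
    obtain ⟨-, hc, hR⟩ := Finset.mem_filter.1 hb
    rw [Finset.mem_union, Finset.mem_biUnion]
    refine (Γ.exists_guess_of_batchCorrect P π hT₀ hT hW hG₀ hj t hc hR).imp ?_ ?_
    · rintro ⟨c, τ, h⟩
      exact ⟨(c, τ), Finset.mem_univ _, Finset.mem_filter.2 ⟨Finset.mem_univ _, h⟩⟩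
    · intro h
      exact Finset.mem_filter.2 ⟨Finset.mem_univ _, h⟩
  have hcard := (Finset.card_le_card hsub).trans ((Finset.card_union_le _ _).trans
    (Nat.add_le_add_right Finset.card_biUnion_le _))
  have hcard' := (Nat.cast_le (α := ℝ)).2 hcard
  refine hcard'.trans ?_
  push_cast
  -- The summand `k` in `ht` is the margin left by the union bound over transcripts. The final
  -- factor 3 counts the two hubs and the event `F`.
  have hM : (Fintype.card {τ : List (Fin k → Message B) // τ.length ≤ R} : ℝ) * (1 / 2) ^ t ≤
      (1 / 2) ^ k := by
    have h1 := card_transcripts_le k B R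
    rw [Nat.card_eq_fintype_card] at h1
    have h2 : (Fintype.card {τ : List (Fin k → Message B) // τ.length ≤ R} : ℝ) ≤
        2 ^ (2 * (B * k + 1) * R) := by exact_mod_cast h1
    calc _ ≤ (2 : ℝ) ^ (2 * (B * k + 1) * R) * (1 / 2) ^ (2 * (B * k + 1) * R + k) := by
          refine mul_le_mul h2 (pow_le_pow_of_le_one (by norm_num) (by norm_num) ht)
            (by positivity) (by positivity)
      _ = (1 / 2) ^ k := by
          rw [pow_add, ← mul_assoc, ← mul_pow]
          norm_num
  have hk : ((1 : ℝ) / 2) ^ t ≤ (1 / 2) ^ k :=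
    pow_le_pow_of_le_one (by norm_num) (by norm_num) (by omega)
  calc _ ≤ ∑ _x : Bool × {τ : List (Fin k → Message B) // τ.length ≤ R}, (1 / 2 : ℝ) ^ t * Ω +
        (1 / 2) ^ t * Ω := add_le_add (Finset.sum_le_sum fun x _ => hE x.1 x.2) hF
    _ = 2 * ((Fintype.card {τ : List (Fin k → Message B) // τ.length ≤ R} : ℝ) * (1 / 2) ^ t) * Ω +
        (1 / 2) ^ t * Ω := by
          rw [Finset.sum_const, Finset.card_univ, Fintype.card_prod, Fintype.card_bool, nsmul_eq_mul]
          push_cast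
          ring
    _ ≤ 2 * (1 / 2) ^ k * Ω + (1 / 2) ^ k * Ω := by gcongr
    _ = _ := by ring

open Classical in
/-- Few partitions are not good. -/
theorem card_not_goodPartition_le (hL : 0 < L) (hk : 0 < k) :
    ((Finset.univ.filter fun π : Fin n → Fin k => ¬ Γ.GoodPartition π).card : ℝ) ≤
      5 / k * (k : ℝ) ^ n := by
  have hk' : (0 : ℝ) < k := by exact_mod_cast hk
  have hcol : ∀ {x y : Fin n}, x ≠ y →
      ((Finset.univ.filter fun π : Fin n → Fin k => π x = π y).card : ℝ) = (k : ℝ) ^ n / k := by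
    intro x y hxy
    rw [eq_div_iff hk'.ne']
    exact_mod_cast card_collision_mul hxy
  let H := Finset.univ.filter fun π : Fin n → Fin k => π (Γ.hub false) = π (Γ.hub true)
  let Q := Finset.univ.filter fun π : Fin n → Fin k => 2 * (Γ.freeLeaves π).card < L
  -- Markov's inequality: the expected number of leaf-hub collisions is `2 * L / k`, and fewer than
  -- `L / 2` free leaves require more than `L / 2` collisions. The event `H` adds `1 / k`.
  have hQ : (Q.card : ℝ) ≤ 4 / k * (k : ℝ) ^ n := by
    have h1 : ∀ π : Fin n → Fin k, L ≤ (Γ.freeLeaves π).card +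
        ∑ i, ∑ c, if π (Γ.hub c) = π (Γ.leaf i) then 1 else 0 := by
      intro π
      calc L = ∑ _i : Fin L, 1 := by simp
        _ ≤ ∑ i, ((if ∀ c, π (Γ.hub c) ≠ π (Γ.leaf i) then 1 else 0) +
            ∑ c, if π (Γ.hub c) = π (Γ.leaf i) then 1 else 0) := by
          refine Finset.sum_le_sum fun i _ => ?_
          split_ifs with h
          · omega
          · push Not at h
            obtain ⟨c, hc⟩ := h
            rw [zero_add]
            refine le_trans ?_ (Finset.single_le_sum (fun _ _ => Nat.zero_le _) (Finset.mem_univ c))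
            rw [if_pos hc]
        _ = _ := by
          rw [Finset.sum_add_distrib]
          congr 1
          unfold freeLeaves
          rw [Finset.card_filter]
    have h2 : Q.card * L ≤ 2 * ∑ π : Fin n → Fin k, ∑ i, ∑ c,
        if π (Γ.hub c) = π (Γ.leaf i) then 1 else 0 := by
      calc Q.card * L = ∑ _π ∈ Q, L := by simp
        _ ≤ ∑ π ∈ Q, 2 * ∑ i, ∑ c, if π (Γ.hub c) = π (Γ.leaf i) then 1 else 0 := by
          refine Finset.sum_le_sum fun π hπ => ?_
          have := (Finset.mem_filter.1 hπ).2
          have := h1 π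
          omega
        _ ≤ ∑ π : Fin n → Fin k, 2 * ∑ i, ∑ c, if π (Γ.hub c) = π (Γ.leaf i) then 1 else 0 :=
          Finset.sum_le_sum_of_subset (Finset.subset_univ _)
        _ = _ := (Finset.mul_sum _ _ _).symm
    have h3 : ((∑ π : Fin n → Fin k, ∑ i, ∑ c,
        if π (Γ.hub c) = π (Γ.leaf i) then 1 else 0 : ℕ) : ℝ) = L * (2 * ((k : ℝ) ^ n / k)) := by
      rw [Finset.sum_comm]
      have : ∀ i : Fin L, ((∑ π : Fin n → Fin k, ∑ c,
          if π (Γ.hub c) = π (Γ.leaf i) then 1 else 0 : ℕ) : ℝ) = 2 * ((k : ℝ) ^ n / k) := by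
        intro i
        rw [Finset.sum_comm, Fintype.sum_bool]
        simp only [← Finset.card_filter]
        push_cast
        rw [hcol (Γ.hub_ne_leaf _ _), hcol (Γ.hub_ne_leaf _ _)]
        ring
      rw [Nat.cast_sum, Finset.sum_congr rfl fun i _ => this i]
      simp
    have h4 : (Q.card : ℝ) * L ≤ 2 * (L * (2 * ((k : ℝ) ^ n / k))) := by
      rw [← h3]
      exact_mod_cast h2
    have hL' : (0 : ℝ) < L := by exact_mod_cast hL
    refine le_of_mul_le_mul_right (h4.trans_eq ?_) hL'
    ring
  have hsub : (Finset.univ.filter fun π : Fin n → Fin k => ¬ Γ.GoodPartition π) ⊆ H ∪ Q := by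
    intro π hπ
    have h := (Finset.mem_filter.1 hπ).2
    rw [Finset.mem_union, Finset.mem_filter, Finset.mem_filter]
    unfold GoodPartition at h
    by_cases h1 : π (Γ.hub false) = π (Γ.hub true)
    · exact Or.inl ⟨Finset.mem_univ _, h1⟩
    · exact Or.inr ⟨Finset.mem_univ _, not_le.1 fun h2 => h ⟨h1, h2⟩⟩
  have hcard := (Nat.cast_le (α := ℝ)).2 ((Finset.card_le_card hsub).trans
    (Finset.card_union_le _ _))
  push_cast at hcard
  have hH : (H.card : ℝ) = (k : ℝ) ^ n / k := hcol (Γ.hub_inj.ne Bool.false_ne_true)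
  refine hcard.trans ?_
  rw [hH]
  refine (add_le_add le_rfl hQ).trans_eq ?_
  ring

end Gadget

/-! ### Expected numbers of rounds -/

variable {k n W B m L N : ℕ}

namespace Algorithm

variable (A : Algorithm k n W B)

theorem expectedTotalRounds_eq_sum (G₀ : WGraph n W) (bs : Fin m → Batch n W) :
    A.expectedTotalRounds G₀ bs = ∑ j, A.expectedBatchRounds G₀ bs j := by
  unfold expectedTotalRounds expectedBatchRounds expect Protocol.totalRounds
  simp only [div_eq_mul_inv]
  rw [← Finset.sum_mul, Finset.sum_comm]
  congr 1
  exact Finset.sum_congr rfl fun π _ =>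
    lintegral_finsetSum _ fun j _ => A.measurable_batchRounds π G₀ bs j

end Algorithm

namespace Gadget

variable (Γ : Gadget n L) {G₀ : WGraph n W} {T : ℕ → Finset (Pair n)}

open Classical in
/-- For fixed coins, an insertion batch is rarely processed correctly within few rounds. -/
theorem card_batchCorrect_pair_le (P : Protocol k n W B)
    (hT₀ : ∀ e ∈ Γ.spokes, (e ∈ T 0 ↔ G₀ e ≠ none))
    (hT : ∀ j, Γ.spokes ⊆ T (j + 1)) (hW : 1 ≤ W) (hG₀ : ∀ e w, G₀ e = some w → 0 < w)
    {j : Fin m} (hj : Odd (j : ℕ)) (hk : 0 < k) {R t : ℕ} (hL : L = 32 * t)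
    (ht : 2 * (B * k + 1) * R + k ≤ t) :
    ((Finset.univ.filter fun x : (Fin n → Fin k) × Bits m L =>
        P.BatchCorrect x.1 G₀ (Γ.hardSeq G₀ T x.2) j ∧
        P.batchRounds x.1 G₀ (Γ.hardSeq G₀ T x.2) j ≤ R).card : ℝ) ≤
      8 / k * (k : ℝ) ^ n * Fintype.card (Bits m L) := by
  set Ω : ℝ := ((Fintype.card (Bits m L) : ℕ) : ℝ) with hΩ
  have hΩ0 : 0 ≤ Ω := Nat.cast_nonneg _
  have hk' : (0 : ℝ) < k := by exact_mod_cast hk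
  let E : (Fin n → Fin k) → Finset (Bits m L) := fun π => Finset.univ.filter fun b =>
    P.BatchCorrect π G₀ (Γ.hardSeq G₀ T b) j ∧ P.batchRounds π G₀ (Γ.hardSeq G₀ T b) j ≤ R
  have hcard : (Finset.univ.filter fun x : (Fin n → Fin k) × Bits m L =>
        P.BatchCorrect x.1 G₀ (Γ.hardSeq G₀ T x.2) j ∧
        P.batchRounds x.1 G₀ (Γ.hardSeq G₀ T x.2) j ≤ R).card = ∑ π, (E π).card := by
    rw [Finset.card_filter, Fintype.sum_prod_type]
    exact Finset.sum_congr rfl fun π _ => (Finset.card_filter _ _).symm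
  have hE : ∀ π, ((E π).card : ℝ) ≤
      3 * (1 / 2) ^ k * Ω + if ¬ Γ.GoodPartition π then Ω else 0 := by
    intro π
    have h0 : 0 ≤ 3 * (1 / 2 : ℝ) ^ k * Ω := by positivity
    split_ifs with h
    · rw [add_zero]
      exact Γ.card_batchCorrect_le P π hT₀ hT hW hG₀ hj h hL ht
    · have h1 : ((E π).card : ℝ) ≤ Ω := Nat.cast_le.2 (Finset.card_le_univ _)
      linarith
  have hpow : (1 / 2 : ℝ) ^ k ≤ 1 / k := by
    rw [one_div, inv_pow, one_div]
    exact inv_anti₀ hk' (by exact_mod_cast k.lt_two_pow_self.le)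
  have hL0 : 0 < L := by omega
  rw [hcard, Nat.cast_sum]
  calc _ ≤ ∑ π : Fin n → Fin k, (3 * (1 / 2) ^ k * Ω + if ¬ Γ.GoodPartition π then Ω else 0) :=
        Finset.sum_le_sum fun π _ => hE π
    _ = (k : ℝ) ^ n * (3 * (1 / 2) ^ k * Ω) +
        ((Finset.univ.filter fun π : Fin n → Fin k => ¬ Γ.GoodPartition π).card : ℝ) * Ω := by
          rw [Finset.sum_add_distrib, Finset.sum_const, ← Finset.sum_filter, Finset.sum_const,
            Finset.card_univ, Fintype.card_fun, Fintype.card_fin, Fintype.card_fin, nsmul_eq_mul,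
            nsmul_eq_mul]
          push_cast
          rfl
    _ ≤ (k : ℝ) ^ n * (3 * (1 / k) * Ω) + 5 / k * (k : ℝ) ^ n * Ω := by
          gcongr
          exact Γ.card_not_goodPartition_le hL0 hk
    _ = _ := by ring

/-- An insertion batch takes many rounds in expectation, on average over the bits. -/
theorem le_sum_expectedBatchRounds (A : Algorithm k n W B)
    (hTN : ∀ j, (T j).card = N) (hT₀ : ∀ e ∈ Γ.spokes, (e ∈ T 0 ↔ G₀ e ≠ none))
    (hT : ∀ j, Γ.spokes ⊆ T (j + 1)) (hW : 1 ≤ W) (hG₀ : ∀ e w, G₀ e = some w → 0 < w)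
    {ε : ℝ} (hA : A.MaintainsMSF G₀ m N ε) (hε : 8 / k ≤ (1 - ε) / 2)
    {j : Fin m} (hj : Odd (j : ℕ)) (hk : 0 < k) {R t : ℕ} (hL : L = 32 * t)
    (ht : 2 * (B * k + 1) * R + k ≤ t) :
    (Fintype.card (Bits m L) : ℝ≥0∞) * (R * ENNReal.ofReal ((1 - ε) / 2)) ≤
      ∑ b : Bits m L, A.expectedBatchRounds G₀ (Γ.hardSeq G₀ T b) j := by
  classical
  set q := ENNReal.ofReal ((1 - ε) / 2) with hq
  set Ω : ℝ≥0∞ := ((Fintype.card (Bits m L) : ℕ) : ℝ≥0∞) with hΩ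
  have hq0 : 0 ≤ (1 - ε) / 2 := le_trans (by positivity) hε
  have hqq : ENNReal.ofReal (1 - ε) = q + q := by
    rw [hq, ← ENNReal.ofReal_add hq0 hq0]
    congr 1
    ring
  have hkn0 : (k : ℝ≥0∞) ^ n ≠ 0 := pow_ne_zero _ (by exact_mod_cast hk.ne')
  have hknt : (k : ℝ≥0∞) ^ n ≠ ⊤ := ENNReal.pow_ne_top (ENNReal.natCast_ne_top k)
  let corr : (Fin n → Fin k) × Bits m L → Set A.Coin := fun x =>
    {ω | (A.proto ω).BatchCorrect x.1 G₀ (Γ.hardSeq G₀ T x.2) j}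
  let rounds : (Fin n → Fin k) × Bits m L → A.Coin → ℝ≥0∞ := fun x ω =>
    (A.proto ω).batchRounds x.1 G₀ (Γ.hardSeq G₀ T x.2) j
  -- A correct run costs more than `R` rounds unless it is fast, and for fixed coins the fast
  -- correct pairs of partition and bits are at most a fraction `q`. As correctness has probability
  -- at least `2 * q`, integration over the coins leaves `R * q`.
  have hpoint : ∀ ω, ∑ x, (corr x).indicator (fun _ => (R : ℝ≥0∞)) ω ≤
      ∑ x, rounds x ω + R * (q * k ^ n * Ω) := by
    intro ω
    let S := Finset.univ.filter fun x => ω ∈ corr x ∧ rounds x ω ≤ R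
    have hS : (S.card : ℝ≥0∞) ≤ q * k ^ n * Ω := by
      have h := Γ.card_batchCorrect_pair_le (A.proto ω) hT₀ hT hW hG₀ hj hk hL ht
      have h2 : (S.card : ℝ) ≤ (1 - ε) / 2 * (k : ℝ) ^ n * ((Fintype.card (Bits m L) : ℕ) : ℝ) := by
        refine h.trans ?_
        gcongr
      have h3 := ENNReal.ofReal_le_ofReal h2
      rwa [ENNReal.ofReal_mul (by positivity), ENNReal.ofReal_mul hq0, ENNReal.ofReal_natCast,
        ENNReal.ofReal_natCast, ENNReal.ofReal_pow (Nat.cast_nonneg _), ENNReal.ofReal_natCast] at h3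
    calc _ ≤ ∑ x, (rounds x ω + if ω ∈ corr x ∧ rounds x ω ≤ R then (R : ℝ≥0∞) else 0) := by
          refine Finset.sum_le_sum fun x _ => ?_
          by_cases hx : ω ∈ corr x
          · rw [Set.indicator_of_mem hx]
            by_cases hr : rounds x ω ≤ R
            · rw [if_pos ⟨hx, hr⟩]
              exact le_add_self
            · rw [if_neg fun h => hr h.2, add_zero]
              exact (not_le.1 hr).le
          · rw [Set.indicator_of_notMem hx]
            exact zero_le
      _ = ∑ x, rounds x ω + R * S.card := by
          rw [Finset.sum_add_distrib, ← Finset.sum_filter, Finset.sum_const, nsmul_eq_mul, mul_comm]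
      _ ≤ _ := by gcongr
  have hint := lintegral_mono (μ := A.μ) hpoint
  have hmeas : ∀ x, Measurable (rounds x) := fun x => A.measurable_batchRounds _ _ _ _
  have hcorr : ∀ x, MeasurableSet (corr x) := fun x => A.measurableSet_batchCorrect _ _ _ _
  rw [lintegral_finsetSum _ fun x _ => measurable_const.indicator (hcorr x),
    lintegral_add_right _ measurable_const, lintegral_finsetSum _ fun x _ => hmeas x,
    lintegral_const, measure_univ, mul_one] at hint
  simp only [lintegral_indicator_const (hcorr _)] at hint
  rw [← Finset.mul_sum, Fintype.sum_prod_type_right, Fintype.sum_prod_type_right] at hint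
  have hprob : ∀ b : Bits m L, (q + q) * k ^ n ≤ ∑ π, A.μ (corr (π, b)) := by
    intro b
    have h := hA (Γ.hardSeq G₀ T b) (Γ.validSeq_hardSeq G₀ T hTN b) j
    rw [hqq] at h
    exact (ENNReal.le_div_iff_mul_le (Or.inl hkn0) (Or.inl hknt)).1 h
  have hexp : ∀ b : Bits m L, ∑ π, ∫⁻ ω, rounds (π, b) ω ∂A.μ =
      A.expectedBatchRounds G₀ (Γ.hardSeq G₀ T b) j * k ^ n :=
    fun b => (ENNReal.div_mul_cancel hkn0 hknt).symm
  have hsum : Ω * ((q + q) * k ^ n) ≤ ∑ b : Bits m L, ∑ π, A.μ (corr (π, b)) := by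
    calc Ω * ((q + q) * k ^ n) = ∑ _b : Bits m L, (q + q) * (k : ℝ≥0∞) ^ n := by
          rw [Finset.sum_const, Finset.card_univ, nsmul_eq_mul]
      _ ≤ _ := Finset.sum_le_sum fun b _ => hprob b
  simp only [hexp] at hint
  rw [← Finset.sum_mul] at hint
  have hfin : (R : ℝ≥0∞) * (q * k ^ n * Ω) ≠ ⊤ :=
    ENNReal.mul_ne_top (ENNReal.natCast_ne_top R) (ENNReal.mul_ne_top
      (ENNReal.mul_ne_top ENNReal.ofReal_ne_top hknt) (ENNReal.natCast_ne_top _))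
  have h1 : R * (q * k ^ n * Ω) + R * (q * k ^ n * Ω) ≤
      (∑ b : Bits m L, A.expectedBatchRounds G₀ (Γ.hardSeq G₀ T b) j) * k ^ n +
        R * (q * k ^ n * Ω) := by
    refine le_trans (le_of_eq ?_) ((mul_le_mul_right hsum (R : ℝ≥0∞)).trans hint)
    ring
  have h2 := (ENNReal.add_le_add_iff_right hfin).1 h1
  refine (ENNReal.mul_le_mul_iff_left hkn0 hknt).1 (le_trans (le_of_eq ?_) h2)
  ring

/-- Averaged over the bits, `m ≥ 2 k` batches take many rounds in expectation. -/
theorem le_sum_expectedTotalRounds (A : Algorithm k n W B)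
    (hTN : ∀ j, (T j).card = N) (hT₀ : ∀ e ∈ Γ.spokes, (e ∈ T 0 ↔ G₀ e ≠ none))
    (hT : ∀ j, Γ.spokes ⊆ T (j + 1)) (hW : 1 ≤ W) (hG₀ : ∀ e w, G₀ e = some w → 0 < w)
    (hm : 2 * k ≤ m) {ε : ℝ} (hA : A.MaintainsMSF G₀ m N ε) (hε : 8 / k ≤ (1 - ε) / 2)
    (hk : 0 < k) {R t : ℕ} (hL : L = 32 * t) (ht : 2 * (B * k + 1) * R + k ≤ t) :
    (Fintype.card (Bits m L) : ℝ≥0∞) * (k * (R * ENNReal.ofReal ((1 - ε) / 2))) ≤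
      ∑ b : Bits m L, A.expectedTotalRounds G₀ (Γ.hardSeq G₀ T b) := by
  simp only [A.expectedTotalRounds_eq_sum]
  rw [Finset.sum_comm]
  -- Since `m ≥ 2 * k`, the indices `2 * i + 1` with `i < k` give `k` insertion batches; the others
  -- are bounded below by 0.
  obtain ⟨o, ho⟩ : ∃ o : Fin k ↪ Fin m, ∀ i, Odd (o i : ℕ) :=
    ⟨⟨fun i => ⟨2 * i + 1, by omega⟩, fun i i' h => by
      rw [Fin.mk.injEq] at h
      exact Fin.ext (by omega)⟩, fun i => ⟨i, rfl⟩⟩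
  have hi : ∀ i : Fin k, (Fintype.card (Bits m L) : ℝ≥0∞) *
      (R * ENNReal.ofReal ((1 - ε) / 2)) ≤ ∑ b : Bits m L,
        A.expectedBatchRounds G₀ (Γ.hardSeq G₀ T b) (o i) := fun i =>
    Γ.le_sum_expectedBatchRounds A hTN hT₀ hT hW hG₀ hA hε (ho i) hk hL ht
  calc _ = ∑ _i : Fin k, (Fintype.card (Bits m L) : ℝ≥0∞) *
        (R * ENNReal.ofReal ((1 - ε) / 2)) := by
        rw [Finset.sum_const, Finset.card_univ, Fintype.card_fin, nsmul_eq_mul]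
        ring
    _ ≤ ∑ i : Fin k, ∑ b : Bits m L,
        A.expectedBatchRounds G₀ (Γ.hardSeq G₀ T b) (o i) :=
        Finset.sum_le_sum fun i _ => hi i
    _ = ∑ j ∈ Finset.univ.map o, ∑ b : Bits m L,
        A.expectedBatchRounds G₀ (Γ.hardSeq G₀ T b) j := by rw [Finset.sum_map]
    _ ≤ _ := Finset.sum_le_sum_of_subset (Finset.subset_univ _)

theorem exists_gadget (h : L + 2 ≤ n) : Nonempty (Gadget n L) :=
  ⟨{ hub := fun c => if c then ⟨0, by omega⟩ else ⟨1, by omega⟩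
     leaf := fun i => ⟨i + 2, by omega⟩
     hub_inj := by
       intro c c' h
       cases c <;> cases c' <;> simp_all
     leaf_inj := by
       intro i i' h
       rw [Fin.mk.injEq] at h
       exact Fin.ext (by omega)
     hub_ne_leaf := by
       intro c i
       cases c <;> simp }⟩

end Gadget

theorem tsum_map_uniform_mul {α β : Type*} [Fintype α] [Nonempty α] (f : α → β) (g : β → ℝ≥0∞) :
    ∑' y, (PMF.uniformOfFintype α).map f y * g y =
      (Fintype.card α : ℝ≥0∞)⁻¹ * ∑ x, g (f x) := by
  classical
  simp only [PMF.map_apply, PMF.uniformOfFintype_apply, ← ENNReal.tsum_mul_right]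
  rw [ENNReal.tsum_comm, tsum_fintype, Finset.mul_sum]
  refine Finset.sum_congr rfl fun x _ => ?_
  simp only [ite_mul, zero_mul]
  rw [tsum_ite_eq]

/-- The lower bound for a fixed number of machines. -/
theorem exists_hard_distribution (hL2 : L + 2 ≤ n) (hN : 2 * L ≤ N) (hn : N + 2 * L ≤ n.choose 2)
    {ε : ℝ} (hε : 8 / k ≤ (1 - ε) / 2) (hk : 0 < k) {R t : ℕ} (hL : L = 32 * t)
    (ht : 2 * (B * k + 1) * R + k ≤ t) (hW : 1 ≤ W) (G₀ : WGraph n W)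
    (hG₀ : ∀ e w, G₀ e = some w → 0 < w) :
    ∃ D : PMF (Fin (3 * k) → Batch n W), (∀ bs ∈ D.support, ValidSeq G₀ N bs) ∧
      ∀ A : Algorithm k n W B, A.MaintainsMSF G₀ (3 * k) N ε →
        (k * (R * ENNReal.ofReal ((1 - ε) / 2)) ≤ ∑' bs, D bs * A.expectedTotalRounds G₀ bs ∧
        ∃ bs ∈ D.support, k * (R * ENNReal.ofReal ((1 - ε) / 2)) ≤ A.expectedTotalRounds G₀ bs ∧
          ∃ j, k * (R * ENNReal.ofReal ((1 - ε) / 2)) / (3 * k : ℕ) ≤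
            A.expectedBatchRounds G₀ bs j) := by
  obtain ⟨Γ⟩ := Gadget.exists_gadget hL2
  obtain ⟨T, hTN, hT₀, hT⟩ := Γ.exists_toggle_sets G₀ hN hn
  refine ⟨(PMF.uniformOfFintype (Bits (3 * k) L)).map (Γ.hardSeq G₀ T), ?_, ?_⟩
  · intro bs hbs
    obtain ⟨b, -, rfl⟩ := (PMF.mem_support_map_iff _ _ _).1 hbs
    exact Γ.validSeq_hardSeq G₀ T hTN b
  · intro A hA
    set q := (k : ℝ≥0∞) * (R * ENNReal.ofReal ((1 - ε) / 2)) with hq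
    have hsum := Γ.le_sum_expectedTotalRounds A hTN hT₀ hT hW hG₀ (by omega) hA hε hk hL ht
    have hcard0 : (Fintype.card (Bits (3 * k) L) : ℝ≥0∞) ≠ 0 := by
      exact_mod_cast Fintype.card_ne_zero
    have hcardt : (Fintype.card (Bits (3 * k) L) : ℝ≥0∞) ≠ ⊤ := ENNReal.natCast_ne_top _
    refine ⟨?_, ?_⟩
    · rw [tsum_map_uniform_mul]
      calc q = (Fintype.card (Bits (3 * k) L) : ℝ≥0∞)⁻¹ *
            ((Fintype.card (Bits (3 * k) L) : ℝ≥0∞) * q) := by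
            rw [← mul_assoc, ENNReal.inv_mul_cancel hcard0 hcardt, one_mul]
        _ ≤ _ := by gcongr
    · have hsum' : ∑ _b : Bits (3 * k) L, q ≤
          ∑ b : Bits (3 * k) L, A.expectedTotalRounds G₀ (Γ.hardSeq G₀ T b) := by
        rw [Finset.sum_const, Finset.card_univ, nsmul_eq_mul]
        exact hsum
      obtain ⟨b, -, hb⟩ := ENNReal.exists_le_of_sum_le Finset.univ_nonempty hsum'
      refine ⟨Γ.hardSeq G₀ T b, (PMF.mem_support_map_iff _ _ _).2 ⟨b, by simp, rfl⟩, hb, ?_⟩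
      have h3k : 0 < 3 * k := by omega
      have : NeZero (3 * k) := ⟨h3k.ne'⟩
      have hsum'' : ∑ _j : Fin (3 * k), q / (3 * k : ℕ) ≤
          ∑ j, A.expectedBatchRounds G₀ (Γ.hardSeq G₀ T b) j := by
        rw [Finset.sum_const, Finset.card_univ, Fintype.card_fin, nsmul_eq_mul,
          ENNReal.mul_div_cancel (by exact_mod_cast h3k.ne') (ENNReal.natCast_ne_top _),
          ← A.expectedTotalRounds_eq_sum]
        exact hb
      obtain ⟨j, -, hj⟩ := ENNReal.exists_le_of_sum_le Finset.univ_nonempty hsum''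
      exact ⟨j, hj⟩

/-! ### Asymptotics -/

theorem clog_two_le (n : ℕ) : (Nat.clog 2 n : ℝ) ≤ 2 * Real.log n + 1 := by
  have hlog : 0 ≤ Real.log n := Real.log_natCast_nonneg n
  have h2 : (0.5 : ℝ) < Real.log 2 := by linarith [Real.log_two_gt_d9]
  have h := Real.natCeil_logb_natCast 2 n
  rw [← h]
  have h0 : 0 ≤ Real.logb ((2 : ℕ) : ℝ) n := by
    rw [Real.logb]
    exact div_nonneg hlog (by push_cast; linarith)
  refine (Nat.ceil_lt_add_one h0).le.trans ?_
  rw [Real.logb]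
  push_cast
  gcongr
  rw [div_le_iff₀ (by linarith)]
  nlinarith

/-- The number of leaves of the hard gadget, divided by `32`. -/
def leafParam (δ : ℝ) (k : ℕ) : ℕ := ⌊(k : ℝ) ^ (1 + δ / 2) / 64⌋₊

/-- A number of rounds that rarely suffices for a batch. -/
def roundParam (δ : ℝ) (C : ℕ) (n : ℕ → ℕ) (k : ℕ) : ℕ :=
  (leafParam δ k - k) / (2 * (C * Nat.clog 2 (n k) * k + 1))

theorem tendsto_rpow_natCast_atTop {δ : ℝ} (hδ : 0 < δ) :
    Tendsto (fun k : ℕ => (k : ℝ) ^ (δ / 2)) atTop atTop :=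
  (tendsto_rpow_atTop (by positivity)).comp tendsto_natCast_atTop_atTop

/-- With `x = k ^ (δ / 2)`, the numerator is of order `k * x` and the denominator at most of order
`k * (C * log n + C + 1)`, so the growth of the quotient is exactly what `hlog` provides. -/
theorem tendsto_roundParam {δ : ℝ} (hδ : 0 < δ) (C : ℕ) (n : ℕ → ℕ)
    (hlog : (fun k : ℕ => Real.log (n k)) =o[atTop] (fun k : ℕ => (k : ℝ) ^ (δ / 2))) :
    Tendsto (fun k => (roundParam δ C n k : ℝ)) atTop atTop := by
  have hx := tendsto_rpow_natCast_atTop hδ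
  have h1 : (fun k : ℕ => 2 * C * Real.log (n k) + (C + 1)) =o[atTop]
      (fun k : ℕ => (k : ℝ) ^ (δ / 2)) :=
    (hlog.const_mul_left _).add
      (Asymptotics.isLittleO_const_left.2 (Or.inr (tendsto_norm_atTop_atTop.comp hx)))
  have h2 : Tendsto (fun k : ℕ => (k : ℝ) ^ (δ / 2) / (2 * C * Real.log (n k) + (C + 1)))
      atTop atTop := by
    have h3 : Tendsto (fun k : ℕ => (2 * C * Real.log (n k) + (C + 1)) / (k : ℝ) ^ (δ / 2))
        atTop (𝓝[>] 0) := by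
      refine tendsto_nhdsWithin_iff.2 ⟨h1.tendsto_div_nhds_zero, ?_⟩
      filter_upwards [eventually_gt_atTop 0] with k hk
      have hk' : (0 : ℝ) < k := by exact_mod_cast hk
      have := Real.log_natCast_nonneg (n k)
      exact Set.mem_Ioi.2 (by positivity)
    refine h3.inv_tendsto_nhdsGT_zero.congr fun k => ?_
    simp
  have h4 : Tendsto (fun k : ℕ =>
      (k : ℝ) ^ (δ / 2) / (2 * C * Real.log (n k) + (C + 1)) * (1 / 256) - 1) atTop atTop :=
    tendsto_atTop_add_const_right _ _ (h2.atTop_mul_const (by norm_num))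
  refine tendsto_atTop_mono' _ ?_ h4
  filter_upwards [hx.eventually_ge_atTop 256, eventually_ge_atTop 1] with k hk hk1
  set x := (k : ℝ) ^ (δ / 2) with hxdef
  set D := 2 * C * Real.log (n k) + (C + 1) with hD
  have hk1' : (1 : ℝ) ≤ k := by exact_mod_cast hk1
  have hlogn := Real.log_natCast_nonneg (n k)
  have hD1 : 1 ≤ D := by
    have : 0 ≤ 2 * C * Real.log (n k) := by positivity
    have : (0 : ℝ) ≤ C := Nat.cast_nonneg C
    linarith
  have hpow : (k : ℝ) ^ (1 + δ / 2) = k * x := by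
    rw [Real.rpow_add (by linarith), Real.rpow_one]
  have ht : k * x / 64 - 1 < leafParam δ k := by
    rw [leafParam, hpow]
    exact Nat.sub_one_lt_floor _
  have hden : (((2 * (C * Nat.clog 2 (n k) * k + 1) : ℕ)) : ℝ) ≤ 2 * D * k := by
    have hc := clog_two_le (n k)
    have h5 : (C : ℝ) * Nat.clog 2 (n k) ≤ C * (2 * Real.log (n k) + 1) := by gcongr
    push_cast
    nlinarith
  have hden0 : (0 : ℝ) < ((2 * (C * Nat.clog 2 (n k) * k + 1) : ℕ) : ℝ) := by positivity
  -- The threshold `x ≥ 256` lets half of `k * x / 64` absorb both `k` and the rounding error 1.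
  have hnum : x * k / 128 ≤ ((leafParam δ k - k : ℕ) : ℝ) := by
    have h6 : (leafParam δ k : ℝ) - k ≤ ((leafParam δ k - k : ℕ) : ℝ) := by
      rw [sub_le_iff_le_add]
      exact_mod_cast le_tsub_add
    nlinarith
  have hfl : ((leafParam δ k - k : ℕ) : ℝ) / ((2 * (C * Nat.clog 2 (n k) * k + 1) : ℕ) : ℝ) - 1 ≤
      roundParam δ C n k := by
    rw [roundParam, ← Nat.floor_div_eq_div (K := ℝ)]
    exact (Nat.sub_one_lt_floor _).le
  refine le_trans (sub_le_sub_right ?_ 1) hfl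
  calc x / D * (1 / 256) = (x * k / 128) / (2 * D * k) := by
        field_simp
        norm_num
    _ ≤ _ := by gcongr

/-- With `x = k ^ (δ / 2)`, the divisor 64 makes `L = 32 * leafParam δ k` at most `k * x / 2`, so
the leaves fit into `n ≥ k * x` vertices and the `2 * L` spokes into a batch of about `k * x ^ 2`
updates. There are about `(k * x) ^ 2 / 2` pairs or more, enough for the filler. -/
theorem eventually_params {δ : ℝ} (hδ : 0 < δ) (C : ℕ) (n : ℕ → ℕ)
    (hn : ∀ᶠ k : ℕ in atTop, (k : ℝ) ^ (1 + δ / 2) ≤ (n k : ℝ)) :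
    ∀ᶠ k : ℕ in atTop, 32 * leafParam δ k + 2 ≤ n k ∧
      2 * (32 * leafParam δ k) ≤ ⌊(k : ℝ) ^ (1 + δ)⌋₊ ∧
      ⌊(k : ℝ) ^ (1 + δ)⌋₊ + 2 * (32 * leafParam δ k) ≤ (n k).choose 2 ∧
      2 * (C * Nat.clog 2 (n k) * k + 1) * roundParam δ C n k + k ≤ leafParam δ k := by
  filter_upwards [hn, (tendsto_rpow_natCast_atTop hδ).eventually_ge_atTop 256,
    eventually_ge_atTop 8] with k hnk hk hk8
  set x := (k : ℝ) ^ (δ / 2) with hxdef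
  have hk8' : (8 : ℝ) ≤ k := by exact_mod_cast hk8
  have hpow : (k : ℝ) ^ (1 + δ / 2) = k * x := by
    rw [Real.rpow_add (by linarith), Real.rpow_one]
  have hpow' : (k : ℝ) ^ (1 + δ) = k * x ^ 2 := by
    rw [Real.rpow_add (by linarith), Real.rpow_one, hxdef, ← Real.rpow_natCast, ← Real.rpow_mul
      (by linarith)]
    congr 2
    push_cast
    ring
  have ht : (leafParam δ k : ℝ) ≤ k * x / 64 := by
    rw [leafParam, hpow]
    exact Nat.floor_le (by positivity)
  have ht' : k * x / 64 - 1 < leafParam δ k := by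
    rw [leafParam, hpow]
    exact Nat.sub_one_lt_floor _
  rw [hpow] at hnk
  have hkx : 8 * 256 ≤ k * x := by nlinarith
  have hkx2 : k * x ≤ k * x ^ 2 := by nlinarith
  have hfl : (⌊(k : ℝ) ^ (1 + δ)⌋₊ : ℝ) ≤ k * x ^ 2 := by
    rw [← hpow']
    exact Nat.floor_le (by positivity)
  refine ⟨?_, ?_, ?_, ?_⟩
  · have : (32 * leafParam δ k + 2 : ℝ) ≤ n k := by linarith
    exact_mod_cast this
  · refine Nat.le_floor ?_
    rw [hpow']
    push_cast
    linarith
  · have h1 : ((⌊(k : ℝ) ^ (1 + δ)⌋₊ + 2 * (32 * leafParam δ k) : ℕ) : ℝ) ≤ (n k).choose 2 := by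
      rw [Nat.cast_choose_two]
      push_cast
      have h2 : (k * x) * (k * x) ≤ n k * n k := mul_self_le_mul_self (by linarith) hnk
      have h3 : 8 * (k * x ^ 2) ≤ (k * x) * (k * x) := by nlinarith [sq_nonneg x]
      nlinarith
    exact_mod_cast h1
  · have h1 : k ≤ leafParam δ k := by
      have : (k : ℝ) ≤ leafParam δ k := by nlinarith
      exact_mod_cast this
    have h2 := Nat.mul_div_le (leafParam δ k - k) (2 * (C * Nat.clog 2 (n k) * k + 1))
    rw [roundParam]
    omega

end KMachine

end

/-! ### The lower bound -/

theorem mainTheorem2 (δ : ℝ) (hδ : 0 < δ) (ε : ℝ) (hε : ε < 1) (C : ℕ) (n : ℕ → ℕ)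
    (hn : ∀ᶠ k : ℕ in atTop, (k : ℝ) ^ (1 + δ / 2) ≤ (n k : ℝ))
    (hlog : (fun k : ℕ => Real.log (n k)) =o[atTop] (fun k : ℕ => (k : ℝ) ^ (δ / 2))) :
    ∃ f : ℕ → ℝ≥0,
      Tendsto (fun k : ℕ => (f k : ℝ) / (k : ℝ)) atTop atTop ∧
      ∀ᶠ k : ℕ in atTop, ∀ W : ℕ, 1 ≤ W →
        ∀ G₀ : KMachine.WGraph (n k) W, (∀ e w, G₀ e = some w → 0 < w) →
        ∃ D : PMF (Fin (3 * k) → KMachine.Batch (n k) W),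
          (∀ bs ∈ D.support, KMachine.ValidSeq G₀ ⌊(k : ℝ) ^ (1 + δ)⌋₊ bs) ∧
          ∀ A : KMachine.Algorithm k (n k) W (C * Nat.clog 2 (n k)),
            A.MaintainsMSF G₀ (3 * k) ⌊(k : ℝ) ^ (1 + δ)⌋₊ ε →
              (f k : ℝ≥0∞) ≤ ∑' bs, D bs * A.expectedTotalRounds G₀ bs ∧
              ∃ bs ∈ D.support,
                (f k : ℝ≥0∞) ≤ A.expectedTotalRounds G₀ bs ∧
                ∃ j, (f k : ℝ≥0∞) / (3 * k : ℕ) ≤ A.expectedBatchRounds G₀ bs j := by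
  have hq : 0 < (1 - ε) / 2 := by linarith
  -- One factor `k` for the insertion batches that are counted, and `R * (1 - ε) / 2` expected
  -- rounds for each.
  refine ⟨fun k => k * (KMachine.roundParam δ C n k * ((1 - ε) / 2).toNNReal), ?_, ?_⟩
  · refine ((KMachine.tendsto_roundParam hδ C n hlog).atTop_mul_const hq).congr' ?_
    filter_upwards [eventually_gt_atTop 0] with k hk
    have hk' : (k : ℝ) ≠ 0 := by exact_mod_cast hk.ne'
    push_cast
    rw [Real.coe_toNNReal _ hq.le, mul_div_cancel_left₀ _ hk']
  · have h8 : ∀ᶠ k : ℕ in atTop, 8 / (k : ℝ) ≤ (1 - ε) / 2 :=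
      (tendsto_const_div_atTop_nhds_zero_nat 8).eventually_le_const hq
    filter_upwards [KMachine.eventually_params hδ C n hn, h8, eventually_gt_atTop 0] with
      k ⟨hL2, hN, hch, ht⟩ hk8 hk W hW G₀ hG₀
    have h := KMachine.exists_hard_distribution hL2 hN hch hk8 hk rfl ht hW G₀ hG₀
    have hf : ((k * (KMachine.roundParam δ C n k * ((1 - ε) / 2).toNNReal) : ℝ≥0) : ℝ≥0∞) =
        k * (KMachine.roundParam δ C n k * ENNReal.ofReal ((1 - ε) / 2)) := by
      push_cast
      rfl
    rw [hf]
    exact h
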